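/- Let $q=2^r$ with $r\ge 1$, let $\mathbb{F}_q$ be the field with $q$ elements, $\mathrm{tr}:\mathbb{F}_q\to\mathbb{F}_2$ the trace, and $\lambda(x)=(-1)^{\mathrm{tr}(x)}$. For $m\ge 1$ and $a\in\mathbb{F}_q^*$ let $$K_m(\lambda;a)=\sum_{\alpha_1,\dots,\alpha_m\in\mathbb{F}_q^*}\lambda(\alpha_1+\cdots+\alpha_m+a\,\alpha_1^{-1}\cdots\alpha_m^{-1}),\qquad K(\lambda;a)=K_1(\lambda;a).$$ For $n\ge 1$ let $$P^+=\left\{\begin{bmatrix}A&0\\0&{}^tA^{-1}\end{bmatrix}\begin{bmatrix}1_n&B\\0&1_n\end{bmatrix} : A\in GL(n,q),\ B \text{ alternating}\right\}$$ (alternating: zero diagonal and ${}^tB=-B$), the maximal parabolic subgroup of the orthogonal group $O^+(2n,q)$ of the quadratic form $\sum_{i=1}^n x_ix_{n+i}$. For $0\le k\le n$ let $\sigma_k^+$ be the $2n\times 2n$ permutation matrix that exchanges the coordinates $i$ and $n+i$ for $1\le i\le k$ and fixes the other coordinates. Put $$DC_1^{\pm}(n,q)=P^+\sigma_{n-1}^+P^+,\qquad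 DC_2^{\pm}(n,q)=P^+\sigma_{n-2}^+P^+,$$ where the sign is $+$ for even $n$ and $-$ for odd $n$: $DC_1^+$ and $DC_2^+$ are defined for even $n\ge 2$, $DC_1^-$ for odd $n\ge 1$, and $DC_2^-$ for odd $n\ge 3$. With ${n\brack k}_q=\prod_{j=0}^{k-1}\frac{q^{n-j}-1}{q^{k-j}-1}$, put $$A_1^+(n,q)=q^{\frac14(5n^2-6n)}{n\brack 1}_q\prod_{j=1}^{n/2}(q^{2j-1}-1),\qquad B_1^+(n,q)=q^{\frac14(n-2)^2}\prod_{j=1}^{n/2}(q^{2j}-1),$$ $$A_2^+(n,q)=q^{\frac14(5n^2-6n)}{n\brack 2}_q\prod_{j=1}^{(n-2)/2}(q^{2j-1}-1),$$ $$B_2^+(n,q)=q^{\frac14(n^2-8n+12)}(q^{n-1}-1)(q^n-1)\prod_{j=1}^{(n-2)/2}(q^{2j}-1),$$ $$A_1^-(n,q)=q^{\frac14(5n^2-4n-1)}{n\brack 1}_q\prod_{j=1}^{(n-1)/2}(q^{2j-1}-1),\qquad B_1^-(n,q)=q^{\frac14(n^2-6n+5)}(q^n-1)\prod_{j=1}^{(n-1)/2}(q^{2j}-1),$$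 $$A_2^-(n,q)=q^{\frac14(5n^2-8n+3)}{n\brack 2}_q\prod_{j=1}^{(n-1)/2}(q^{2j-1}-1),\qquad B_2^-(n,q)=q^{\frac14(n-3)^2}(q^n-1)\prod_{j=1}^{(n-1)/2}(q^{2j}-1).$$ For $i=1,2$ let $N=N_i^{\pm}(n,q)=|DC_i^{\pm}(n,q)|$, and let $g_1,\dots,g_N$ be any ordering of the elements of $DC_i^{\pm}(n,q)$. Let $C(DC_i^{\pm}(n,q))=\{u\in\mathbb{F}_2^N : \sum_j u_j\,\mathrm{Tr}\,g_j=0\}$, where $\mathrm{Tr}$ is the matrix trace, and for $a\in\mathbb{F}_q$ let $$c_i^{\pm}(a)=(\mathrm{tr}(a\,\mathrm{Tr}\,g_1),\dots,\mathrm{tr}(a\,\mathrm{Tr}\,g_N))\in\mathbb{F}_2^N .$$ Then, for every $a\in\mathbb{F}_q^*$ and every $n$ for which the objects are defined, $c_i^{\pm}(a)$ lies in the dual code $C(DC_i^{\pm}(n,q))^{\perp}$, and the Hamming weights are $$w(c_1^{\pm}(a))=\tfrac12A_1^{\pm}(n,q)\bigl(B_1^{\pm}(n,q)-K(\lambda;a)\bigr),$$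 $$w(c_2^{\pm}(a))=\tfrac12A_2^{\pm}(n,q)\bigl(B_2^{\pm}(n,q)-q^2+q-K(\lambda;a)^2\bigr)=\tfrac12A_2^{\pm}(n,q)\bigl(B_2^{\pm}(n,q)-q^2-K_2(\lambda;a)\bigr).$$ -/

import Mathlib

noncomputable section

namespace OrthoKloosterman

/-! ### Additive characters and Kloosterman sums -/

/-- The canonical additive character `lam x = (-1) ^ tr x` of a finite field `F` of
characteristic two, `tr` being the trace to `F_2`. -/
def lam (F : Type*) [Field F] [Algebra (ZMod 2) F] : AddChar F ℝ where
  toFun x := (-1) ^ (Algebra.trace (ZMod 2) F x).val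
  map_zero_eq_one' := by simp
  map_add_eq_mul' x y := by
    rw [map_add]
    generalize Algebra.trace (ZMod 2) F x = s
    generalize Algebra.trace (ZMod 2) F y = t
    rw [ZMod.val_add, ← pow_add]
    exact (neg_one_pow_eq_pow_mod_two _).symm

/-- The `m`-dimensional Kloosterman sum
`∑ ψ (α_1 + ⋯ + α_m + a α_1⁻¹ ⋯ α_m⁻¹)`, over all nonzero `α_1, …, α_m`. -/
def kloostermanDim {F : Type*} [Field F] [Fintype F] [DecidableEq F]
    (m : ℕ) (ψ : AddChar F ℝ) (a : F) : ℝ :=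
  ∑ α : Fin m → Fˣ, ψ ((∑ i, (α i : F)) + a * ∏ i, (α i : F)⁻¹)

/-- The (one-dimensional) Kloosterman sum. -/
def kloosterman {F : Type*} [Field F] [Fintype F] [DecidableEq F]
    (ψ : AddChar F ℝ) (a : F) : ℝ :=
  kloostermanDim 1 ψ a

/-! ### Double cosets of the maximal parabolic subgroup of `O⁺(2n,q)`

Matrices of size `2n` are indexed by `Fin n ⊕ Fin n`. -/

/-- Alternating matrices: zero diagonal and `B i j = - B j i`. -/
def IsAlternating {F : Type*} [Field F] {n : ℕ} (B : Matrix (Fin n) (Fin n) F) : Prop :=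
  (∀ i, B i i = 0) ∧ ∀ i j, B i j = -B j i

/-- The maximal parabolic subgroup `P⁺(2n,q)` (as a set of matrices). -/
def parabolic (F : Type*) [Field F] (n : ℕ) : Set (Matrix (Fin n ⊕ Fin n) (Fin n ⊕ Fin n) F) :=
  {w | ∃ (A : GL (Fin n) F) (B : Matrix (Fin n) (Fin n) F), IsAlternating B ∧
    w = Matrix.fromBlocks (A : Matrix (Fin n) (Fin n) F) 0 0
          (((A⁻¹ : GL (Fin n) F) : Matrix (Fin n) (Fin n) F).transpose) *
        Matrix.fromBlocks 1 B 0 1}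

/-- The involution `σ_r⁺`, exchanging the coordinates `i` and `n + i` for the first `r`
indices `i`, and fixing the others. -/
def sigmaMat (F : Type*) [Field F] (n r : ℕ) : Matrix (Fin n ⊕ Fin n) (Fin n ⊕ Fin n) F :=
  Matrix.fromBlocks
    (Matrix.diagonal fun i : Fin n => if (i : ℕ) < r then 0 else 1)
    (Matrix.diagonal fun i : Fin n => if (i : ℕ) < r then 1 else 0)
    (Matrix.diagonal fun i : Fin n => if (i : ℕ) < r then 1 else 0)
    (Matrix.diagonal fun i : Fin n => if (i : ℕ) < r then 0 else 1)

/-- `DC F n i` is the double coset `P⁺ σ_{n-i}⁺ P⁺` (used only for `i ≤ n`). It is `DC_i⁺(n,q)`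
when `n` is even and `DC_i⁻(n,q)` when `n` is odd. -/
def DC (F : Type*) [Field F] (n i : ℕ) : Set (Matrix (Fin n ⊕ Fin n) (Fin n ⊕ Fin n) F) :=
  DoubleCoset.doubleCoset (sigmaMat F n (n - i)) (parabolic F n) (parabolic F n)

/-- The length `N_i(n,q)` of the codes: the number of elements of `DC F n i`. -/
def len (F : Type*) [Field F] (n i : ℕ) : ℕ := Nat.card (DC F n i)

/-! ### Binary codes -/

/-- The binary code of all `u ∈ F_2^N` with `u · v = 0` in `F`, for `v ∈ F^N`. -/
def binaryCode {F : Type*} [Field F] [Algebra (ZMod 2) F] {N : ℕ} (v : Fin N → F) :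
    Submodule (ZMod 2) (Fin N → ZMod 2) where
  carrier := {u | ∑ j, algebraMap (ZMod 2) F (u j) * v j = 0}
  zero_mem' := by simp
  add_mem' {u u'} hu hu' := by
    simp only [Set.mem_ofPred_eq] at hu hu' ⊢
    simp [add_mul, Finset.sum_add_distrib, hu, hu']
  smul_mem' c u hu := by
    simp only [Set.mem_ofPred_eq] at hu ⊢
    simp [mul_assoc, ← Finset.mul_sum, hu]

/-- The dual of a binary linear code. -/
def dualCode {N : ℕ} (C : Submodule (ZMod 2) (Fin N → ZMod 2)) :
    Submodule (ZMod 2) (Fin N → ZMod 2) where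
  carrier := {c | ∀ u ∈ C, ∑ j, c j * u j = 0}
  zero_mem' := by simp
  add_mem' {c c'} hc hc' u hu := by
    simp [add_mul, Finset.sum_add_distrib, hc u hu, hc' u hu]
  smul_mem' s c hc u hu := by
    simp [mul_assoc, ← Finset.mul_sum, hc u hu]

/-- The vector `(Tr g_1, …, Tr g_N)` of matrix traces, for an ordering `g` of `DC F n i`. -/
def traceVec {F : Type*} [Field F] {n i N : ℕ} (g : Fin N ≃ DC F n i) : Fin N → F :=
  fun j => (g j : Matrix (Fin n ⊕ Fin n) (Fin n ⊕ Fin n) F).trace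

/-- The word `c(a) = (tr (a Tr g_1), …, tr (a Tr g_N))`. -/
def codeword {F : Type*} [Field F] [Algebra (ZMod 2) F] {n i N : ℕ} (g : Fin N ≃ DC F n i)
    (a : F) : Fin N → ZMod 2 :=
  fun j => Algebra.trace (ZMod 2) F (a * traceVec g j)

/-! ### The numbers `A_i^±(n,q)` and `B_i^±(n,q)`

The `+` versions are used for even `n`, the `-` versions for odd `n`; the divisions by `4` in the
(integer, possibly negative) exponents are then exact. -/

/-- The `q`-binomial coefficient. -/
def qBinom (q n r : ℕ) : ℝ :=
  ∏ j ∈ Finset.range r, ((q : ℝ) ^ (n - j) - 1) / ((q : ℝ) ^ (r - j) - 1)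

/-- `∏_{j=1}^{m} (q^{2j-1} - 1)`. -/
def oddProd (q m : ℕ) : ℝ := ∏ j ∈ Finset.Icc 1 m, ((q : ℝ) ^ (2 * j - 1) - 1)

/-- `∏_{j=1}^{m} (q^{2j} - 1)`. -/
def evenProd (q m : ℕ) : ℝ := ∏ j ∈ Finset.Icc 1 m, ((q : ℝ) ^ (2 * j) - 1)

def A1plus (n q : ℕ) : ℝ :=
  (q : ℝ) ^ ((5 * (n : ℤ) ^ 2 - 6 * n) / 4) * qBinom q n 1 * oddProd q (n / 2)

def B1plus (n q : ℕ) : ℝ :=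
  (q : ℝ) ^ (((n : ℤ) - 2) ^ 2 / 4) * evenProd q (n / 2)

def A2plus (n q : ℕ) : ℝ :=
  (q : ℝ) ^ ((5 * (n : ℤ) ^ 2 - 6 * n) / 4) * qBinom q n 2 * oddProd q ((n - 2) / 2)

def B2plus (n q : ℕ) : ℝ :=
  (q : ℝ) ^ (((n : ℤ) ^ 2 - 8 * n + 12) / 4) * ((q : ℝ) ^ (n - 1) - 1) * ((q : ℝ) ^ n - 1) *
    evenProd q ((n - 2) / 2)

def A1minus (n q : ℕ) : ℝ :=
  (q : ℝ) ^ ((5 * (n : ℤ) ^ 2 - 4 * n - 1) / 4) * qBinom q n 1 * oddProd q ((n - 1) / 2)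

def B1minus (n q : ℕ) : ℝ :=
  (q : ℝ) ^ (((n : ℤ) ^ 2 - 6 * n + 5) / 4) * ((q : ℝ) ^ n - 1) * evenProd q ((n - 1) / 2)

def A2minus (n q : ℕ) : ℝ :=
  (q : ℝ) ^ ((5 * (n : ℤ) ^ 2 - 8 * n + 3) / 4) * qBinom q n 2 * oddProd q ((n - 1) / 2)

def B2minus (n q : ℕ) : ℝ :=
  (q : ℝ) ^ (((n : ℤ) - 3) ^ 2 / 4) * ((q : ℝ) ^ n - 1) * evenProd q ((n - 1) / 2)

end OrthoKloosterman

end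

noncomputable section

namespace OrthoKloosterman

open Matrix

set_option linter.unusedSectionVars false

/-! ### The canonical character and Kloosterman sums -/

/-! Since λ takes the value 1 or -1 according to the trace, twice the weight of c(a) is N - ∑ λ(a Tr
g), the sum running over the double coset PσP. Everything reduces to N and this exponential sum.
That c(a) lies in the dual code is only F_2-linearity of the field trace.

Write n = r + t, σ = σ_r, and let D be the projection on the first r coordinates. The map (x, y) ↦
xσy from P × P onto PσP has fibres of constant size |P ∩ σPσ| (`card_mul_sum_doubleCoset`). As
Tr(xσy) = Tr(yxσ), the sum over P × P is |P| times a sum over x alone (`stabCard_mul_sum`). For x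
with parameters (A, B), Tr(xσ) depends on B only through Tr(DAB), and summing over alternating B
kills every A for which DA is not symmetric (`sum_lam_isAlt`). The surviving A are block lower
triangular, with a symmetric invertible r × r block, a free off-diagonal block and a block in GL(t,
q). The sum therefore factors into the number of invertible symmetric matrices, a power of q, and ∑
λ(a(Tr A + Tr A⁻¹)) over GL(t, q) (`leviSum_fromBlocks`).

For t = 1 the last sum is K(λ;a), and for t = 2 it is q(K(λ;a)² + q² - q) (`glSum_one`,
`glSum_two`). The orders of GL and the count of invertible symmetric matrices (`symCard_even_odd`)
then produce the constants A and B. The second form of the weight for t = 2 is the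
characteristic-two identity K² = K_2 + q (`kloosterman_sq`). -/

theorem charP_two (F : Type*) [Field F] [Algebra (ZMod 2) F] : CharP F 2 :=
  charP_of_injective_algebraMap (algebraMap (ZMod 2) F).injective 2

section Kloosterman

variable {F : Type*} [Field F] [Fintype F] [DecidableEq F]

theorem sum_units_eq_sum_ite {R : Type*} [AddCommMonoid R] (f : F → R) :
    ∑ u : Fˣ, f u = ∑ x : F, if x ≠ 0 then f x else 0 := by
  rw [← Finset.sum_filter, Finset.sum_subtype (p := fun x : F => x ≠ 0) _ (by simp)]
  exact Fintype.sum_equiv unitsEquivNeZero _ _ (fun _ => rfl)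

variable [Algebra (ZMod 2) F]

/-- The trace is invariant under Frobenius. -/
theorem lam_sq (x : F) : lam F (x ^ 2) = lam F x := by
  have h := Algebra.trace_eq_of_algEquiv
    (FiniteField.frobeniusAlgEquivOfAlgebraic (ZMod 2) F) x
  rw [FiniteField.coe_frobeniusAlgEquivOfAlgebraic] at h
  simp only [ZMod.card] at h
  change (-1 : ℝ) ^ (Algebra.trace (ZMod 2) F (x ^ 2)).val = _
  rw [h]
  rfl

theorem lam_ne_zero : lam F ≠ 0 := by
  intro h
  obtain ⟨x, hx⟩ := Algebra.trace_surjective (ZMod 2) F 1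
  have h1 : lam F x = 1 := by rw [h]; rfl
  change (-1 : ℝ) ^ (Algebra.trace (ZMod 2) F x).val = 1 at h1
  rw [hx] at h1
  norm_num [ZMod.val_one] at h1

theorem sum_lam : ∑ x : F, lam F x = 0 :=
  AddChar.sum_eq_zero_iff_ne_zero.2 lam_ne_zero

theorem sum_lam_mul (c : F) : ∑ x : F, lam F (c * x) = if c = 0 then (Fintype.card F : ℝ) else 0 := by
  split_ifs with h
  · simp [h]
  · rw [← sum_lam (F := F)]
    exact Fintype.sum_equiv (Equiv.mulLeft₀ c h) _ _ (fun _ => rfl)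

theorem kloosterman_eq (ψ : AddChar F ℝ) (a : F) :
    kloosterman ψ a = ∑ x : Fˣ, ψ (x + a * (x : F)⁻¹) := by
  unfold kloosterman kloostermanDim
  exact Fintype.sum_equiv (Equiv.funUnique (Fin 1) Fˣ) _ _ (fun α => by simp [Equiv.funUnique])

theorem kloostermanDim_two_eq (ψ : AddChar F ℝ) (a : F) :
    kloostermanDim 2 ψ a = ∑ x : Fˣ, ∑ y : Fˣ, ψ (x + y + a * ((x : F)⁻¹ * (y : F)⁻¹)) := by
  unfold kloostermanDim
  rw [← Fintype.sum_prod_type' (f := fun x y : Fˣ => ψ (x + y + a * ((x : F)⁻¹ * (y : F)⁻¹)))]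
  exact Fintype.sum_equiv (finTwoArrowEquiv Fˣ) _ _ (fun α => by
    simp [Fin.sum_univ_two, mul_comm])

theorem sq_units_bijective : Function.Bijective (fun u : Fˣ => u ^ 2) := by
  have := charP_two F
  refine Finite.injective_iff_bijective.1 fun u v h => ?_
  have h' : (u : F) ^ 2 = (v : F) ^ 2 := by simpa using congrArg Units.val h
  exact Units.ext (frobenius_inj F 2 (by simpa [frobenius_def] using h'))

/-- The substitution y = ax gives the Kloosterman sum at a². Replacing y by a square, which permutes
the units in characteristic two, turns the argument into the square of y + a/y, and λ ignores
squaring. -/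
theorem sum_lam_scaled {a : F} (ha : a ≠ 0) :
    ∑ x : Fˣ, lam F (a * x + a * (x : F)⁻¹) = kloosterman (lam F) a := by
  have := charP_two F
  rw [kloosterman_eq]
  have h1 : ∑ x : Fˣ, lam F (a * x + a * (x : F)⁻¹) =
      ∑ y : Fˣ, lam F (y + a ^ 2 * (y : F)⁻¹) :=
    Fintype.sum_equiv (Equiv.mulLeft (Units.mk0 a ha)) _ _ (fun x => by
      congr 1
      have := x.ne_zero
      simp
      field_simp)
  rw [h1, ← sq_units_bijective.sum_comp]
  refine Finset.sum_congr rfl fun x _ => ?_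
  rw [← lam_sq (_ + _ * (x : F)⁻¹), CharTwo.add_sq]
  congr 1
  simp [mul_pow]

/-- Both sides become sums over t of inner sums over the units. In K² the second variable is x times
t; for t ≠ 1 the rescaling u = x(1 + t) gives u + a(t + t⁻¹)/u, which is also the summand for K_2.
Only t = 1 differs: it contributes q - 1 to K² and ∑ λ(u) = -1 to K_2. -/
theorem kloosterman_sq {a : F} (ha : a ≠ 0) :
    kloosterman (lam F) a ^ 2 = kloostermanDim 2 (lam F) a + Fintype.card F := by
  have := charP_two F
  have hK2 : kloostermanDim 2 (lam F) a =
      ∑ t : Fˣ, ∑ u : Fˣ, lam F (u + a * (t + (t : F)⁻¹) * (u : F)⁻¹) := by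
    rw [kloostermanDim_two_eq, Finset.sum_comm (s := (Finset.univ : Finset Fˣ))]
    rw [Finset.sum_comm]
    conv_rhs => rw [Finset.sum_comm]
    refine Finset.sum_congr rfl fun u _ => ?_
    -- With t = a⁻¹uw², the terms at/u and a/(tu) are the squares of w and a/(uw), so `lam_sq`
    -- recovers the summand of K_2.
    refine Function.Bijective.sum_comp (e := fun w : Fˣ => (Units.mk0 a ha)⁻¹ * u * w ^ 2) ?_
      (fun t : Fˣ => lam F (u + a * (t + (t : F)⁻¹) * (u : F)⁻¹)) |>.symm.trans ?_ |>.symm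
    · exact (Group.mulLeft_bijective _).comp sq_units_bijective
    · refine Finset.sum_congr rfl fun w _ => ?_
      have hw := w.ne_zero
      have hu := u.ne_zero
      rw [add_assoc, AddChar.map_add_eq_mul, AddChar.map_add_eq_mul,
        ← lam_sq ((w : F) + a * ((u : F)⁻¹ * (w : F)⁻¹)), CharTwo.add_sq]
      congr 2
      simp
      field_simp
  have hK : kloosterman (lam F) a ^ 2 =
      ∑ t : Fˣ, ∑ x : Fˣ, lam F (x * (1 + t) + a * (1 + t) * ((t : F)⁻¹ * (x : F)⁻¹)) := by
    rw [kloosterman_eq, sq, Finset.sum_mul_sum]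
    conv_rhs => rw [Finset.sum_comm]
    refine Finset.sum_congr rfl fun x _ => ?_
    refine (Fintype.sum_equiv (Equiv.mulLeft x) _ _ fun t => ?_).symm
    rw [← AddChar.map_add_eq_mul]
    have ht := t.ne_zero
    have hx := x.ne_zero
    congr 1
    simp
    field_simp
    ring
  have hne : ∀ t : Fˣ, t ≠ 1 →
      ∑ x : Fˣ, lam F (x * (1 + t) + a * (1 + t) * ((t : F)⁻¹ * (x : F)⁻¹)) =
      ∑ u : Fˣ, lam F (u + a * (t + (t : F)⁻¹) * (u : F)⁻¹) := fun t ht => by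
    have h1 : (1 + t : F) ≠ 0 := fun h => ht (Units.ext (by
      rw [add_comm] at h
      simpa using CharTwo.add_eq_zero.1 h))
    refine Fintype.sum_equiv (Equiv.mulRight (Units.mk0 _ h1)) _ _ fun x => ?_
    have ht := t.ne_zero
    have hx := x.ne_zero
    congr 1
    simp
    field_simp
    rw [CharTwo.add_sq]
    ring
  have h1 : ∑ u : Fˣ, lam F (u : F) = -1 := by
    have := sum_lam (F := F)
    rw [sum_units_eq_sum_ite (fun x => lam F x)]
    rw [← Finset.add_sum_erase _ _ (Finset.mem_univ (0 : F))] at this ⊢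
    rw [Finset.sum_congr rfl (g := fun x => lam F x)]
    · simp at this ⊢
      linarith
    · intro x hx
      simp [Finset.ne_of_mem_erase hx]
  rw [hK, hK2, ← Finset.add_sum_erase _ _ (Finset.mem_univ (1 : Fˣ)),
    ← Finset.add_sum_erase _
      (fun t : Fˣ => ∑ u : Fˣ, lam F (u + a * (t + (t : F)⁻¹) * (u : F)⁻¹))
      (Finset.mem_univ (1 : Fˣ)),
    Finset.sum_congr rfl (fun t ht => hne t (Finset.ne_of_mem_erase ht))]
  simp only [Units.val_one, inv_one, CharTwo.add_self_eq_zero, mul_zero, zero_mul,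
    AddChar.map_zero_eq_one, add_zero, h1]
  rw [Finset.sum_const, Finset.card_univ, Fintype.card_units]
  have : 1 ≤ Fintype.card F := Fintype.card_pos
  push_cast [Nat.cast_sub this, nsmul_eq_mul]
  ring

/-- The Kloosterman sum for the general linear group. -/
def glSum (ι : Type*) [Fintype ι] [DecidableEq ι] (a : F) : ℝ :=
  ∑ A : Matrix ι ι F, if A.det ≠ 0 then lam F (a * (A.trace + A⁻¹.trace)) else 0

theorem glSum_one {a : F} (ha : a ≠ 0) : glSum (Fin 1) a = kloosterman (lam F) a := by
  rw [← sum_lam_scaled ha, sum_units_eq_sum_ite (fun x => lam F (a * x + a * x⁻¹))]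
  refine Fintype.sum_equiv Matrix.uniqueEquiv _ _ fun A => ?_
  rw [Matrix.inv_def, Matrix.det_fin_one, Matrix.adjugate_fin_one, Matrix.trace_fin_one,
    Matrix.trace_smul, Matrix.trace_fin_one]
  simp [mul_add]

/-- A `2 × 2` matrix is the same as its four entries. -/
def matrixTwoEquiv (R : Type*) : R × R × R × R ≃ Matrix (Fin 2) (Fin 2) R where
  toFun p := !![p.1, p.2.1; p.2.2.1, p.2.2.2]
  invFun A := (A 0 0, A 0 1, A 1 0, A 1 1)
  left_inv p := by simp
  right_inv A := by ext i j; fin_cases i <;> fin_cases j <;> rfl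

/-- For a matrix with rows (x, y), (z, w) and determinant d, Tr A + Tr A⁻¹ = (x + w)(1 + d⁻¹). If y
= 0 the sum splits into two Kloosterman sums, with z free. If y ≠ 0, then d can replace z as a
variable, and the sums over x and w vanish unless d = 1, where they give q². -/
theorem glSum_two {a : F} (ha : a ≠ 0) : glSum (Fin 2) a =
    (Fintype.card F : ℝ) * kloosterman (lam F) a ^ 2 +
      (Fintype.card F : ℝ) ^ 2 * ((Fintype.card F : ℝ) - 1) := by
  have := charP_two F
  set f : F → F → F → F → ℝ := fun x y z w =>
    if x * w - y * z ≠ 0 then lam F (a * (x + w) * (1 + (x * w - y * z)⁻¹)) else 0 with hf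
  have h0 : glSum (Fin 2) a = ∑ y : F, ∑ x : F, ∑ z : F, ∑ w : F, f x y z w := by
    rw [Finset.sum_comm]
    unfold glSum
    rw [← (matrixTwoEquiv F).sum_comp]
    simp only [Fintype.sum_prod_type]
    refine Finset.sum_congr rfl fun x _ => Finset.sum_congr rfl fun y _ =>
      Finset.sum_congr rfl fun z _ => Finset.sum_congr rfl fun w _ => ?_
    simp only [matrixTwoEquiv, Equiv.coe_fn_mk, hf, det_fin_two_of, inv_def, adjugate_fin_two_of,
      trace_smul, trace_fin_two_of, Ring.inverse_eq_inv', smul_eq_mul]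
    congr 2
    ring
  have hy0 : ∑ x : F, ∑ z : F, ∑ w : F, f x 0 z w =
      (Fintype.card F : ℝ) * kloosterman (lam F) a ^ 2 := by
    rw [Finset.sum_comm, ← sum_lam_scaled ha,
      sum_units_eq_sum_ite (fun x => lam F (a * x + a * x⁻¹)), sq, Finset.sum_mul_sum]
    rw [Finset.sum_congr rfl (g := fun _ => ∑ x : F, ∑ w : F,
      (if x ≠ 0 then lam F (a * x + a * x⁻¹) else 0) *
        (if w ≠ 0 then lam F (a * w + a * w⁻¹) else 0))]
    · simp
    intro z _
    refine Finset.sum_congr rfl fun x _ => Finset.sum_congr rfl fun w _ => ?_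
    by_cases hx : x = 0
    · simp [hf, hx]
    by_cases hw : w = 0
    · simp [hf, hw]
    simp only [hf, zero_mul, sub_zero, ne_eq, mul_eq_zero, hx, hw, or_self, not_false_eq_true,
      if_true]
    rw [← AddChar.map_add_eq_mul]
    congr 1
    field_simp
    ring
  have hy : ∀ y : F, y ≠ 0 → ∑ x : F, ∑ z : F, ∑ w : F, f x y z w = (Fintype.card F : ℝ) ^ 2 := by
    intro y hy
    have h1 : ∀ x w : F, ∑ z : F, f x y z w =
        ∑ d : F, if d ≠ 0 then lam F (a * (1 + d⁻¹) * x) * lam F (a * (1 + d⁻¹) * w) else 0 := by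
      intro x w
      refine Fintype.sum_equiv ((Equiv.mulLeft₀ y hy).trans (Equiv.subLeft (x * w))) _ _ fun z => ?_
      simp only [hf, Equiv.trans_apply, Equiv.mulLeft₀_apply, Equiv.subLeft_apply]
      congr 1
      rw [← AddChar.map_add_eq_mul]
      congr 1
      ring
    calc ∑ x : F, ∑ z : F, ∑ w : F, f x y z w
        = ∑ x : F, ∑ w : F, ∑ d : F,
            if d ≠ 0 then lam F (a * (1 + d⁻¹) * x) * lam F (a * (1 + d⁻¹) * w) else 0 := by
          refine Finset.sum_congr rfl fun x _ => ?_
          rw [Finset.sum_comm]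
          exact Finset.sum_congr rfl fun w _ => h1 x w
      _ = ∑ d : F, if d ≠ 0 then
            (∑ x : F, lam F (a * (1 + d⁻¹) * x)) * ∑ w : F, lam F (a * (1 + d⁻¹) * w) else 0 := by
          rw [Finset.sum_congr rfl fun x _ => Finset.sum_comm, Finset.sum_comm]
          refine Finset.sum_congr rfl fun d _ => ?_
          split_ifs
          · rw [Finset.sum_mul_sum]
          · simp
      _ = ∑ d : F, if d = 1 then (Fintype.card F : ℝ) ^ 2 else 0 := by
          refine Finset.sum_congr rfl fun d _ => ?_
          rw [sum_lam_mul]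
          by_cases hd : d = 1
          · simp [hd, CharTwo.add_self_eq_zero, sq]
          · have : (1 : F) + d⁻¹ ≠ 0 := fun h => hd (by
              have := CharTwo.add_eq_zero.1 h
              rw [← inv_inv d, ← this, inv_one])
            simp [hd, this, ha]
      _ = _ := by simp
  rw [h0, ← Finset.add_sum_erase _ _ (Finset.mem_univ (0 : F)), hy0,
    Finset.sum_congr rfl (fun y h => hy y (Finset.ne_of_mem_erase h))]
  rw [Finset.sum_const, Finset.card_erase_of_mem (Finset.mem_univ _), Finset.card_univ]
  have : 1 ≤ Fintype.card F := Fintype.card_pos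
  push_cast [Nat.cast_sub this, nsmul_eq_mul]
  ring

end Kloosterman

/-! ### Counting matrices over a finite field -/

section Counting

variable {F : Type*} [Field F] [Fintype F] [DecidableEq F]
variable {ι κ α β : Type*} [Fintype ι] [DecidableEq ι] [Fintype κ] [DecidableEq κ]
  [Fintype α] [DecidableEq α] [Fintype β] [DecidableEq β]

/-- A matrix on a disjoint union is the same as its four blocks. -/
def blocksEquiv (α β R : Type*) : Matrix α α R × Matrix α β R × Matrix β α R × Matrix β β R ≃
    Matrix (α ⊕ β) (α ⊕ β) R where
  toFun p := fromBlocks p.1 p.2.1 p.2.2.1 p.2.2.2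
  invFun S := (S.toBlocks₁₁, S.toBlocks₁₂, S.toBlocks₂₁, S.toBlocks₂₂)
  left_inv p := by simp
  right_inv S := fromBlocks_toBlocks S

theorem sum_blocks {R : Type*} [AddCommMonoid R] (f : Matrix (α ⊕ β) (α ⊕ β) F → R) :
    ∑ S, f S = ∑ A, ∑ B, ∑ C, ∑ D, f (fromBlocks A B C D) := by
  rw [← (blocksEquiv α β F).sum_comp]
  simp only [Fintype.sum_prod_type]
  rfl

theorem card_matrix (ι κ : Type*) [Fintype ι] [DecidableEq ι] [Fintype κ] [DecidableEq κ] :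
    Fintype.card (Matrix ι κ F) = Fintype.card F ^ (Fintype.card ι * Fintype.card κ) := by
  rw [show Fintype.card (Matrix ι κ F) = Fintype.card (ι → κ → F) from rfl]
  simp [← pow_mul, mul_comm]

/-! #### Alternating matrices -/

/-- Alternating matrices over an arbitrary index type. -/
def IsAlt (B : Matrix ι ι F) : Prop :=
  (∀ i, B i i = 0) ∧ ∀ i j, B i j = -B j i

instance (B : Matrix ι ι F) : Decidable (IsAlt B) :=
  Classical.propDecidable _

theorem IsAlt.add {B C : Matrix ι ι F} (hB : IsAlt B) (hC : IsAlt C) : IsAlt (B + C) :=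
  ⟨fun i => by simp [hB.1, hC.1], fun i j => by
    rw [Matrix.add_apply, Matrix.add_apply, hB.2 i j, hC.2 i j]; ring⟩

theorem IsAlt.neg {B : Matrix ι ι F} (hB : IsAlt B) : IsAlt (-B) :=
  ⟨fun i => by simp [hB.1], fun i j => by rw [Matrix.neg_apply, Matrix.neg_apply, hB.2 i j]⟩

theorem IsAlt.zero : IsAlt (0 : Matrix ι ι F) := ⟨by simp, by simp⟩

theorem IsAlt.sub_transpose (U : Matrix ι ι F) : IsAlt (U - Uᵀ) :=
  ⟨by simp, by simp⟩

/-- The entries above the diagonal, for any ordering of the indices, determine B. This form makes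
congruence and trace identities formal and is valid in characteristic two. -/
theorem IsAlt.exists_eq_sub_transpose {B : Matrix ι ι F} (hB : IsAlt B) :
    ∃ U : Matrix ι ι F, B = U - Uᵀ := by
  let e := Fintype.equivFin ι
  refine ⟨Matrix.of fun i j => if e i < e j then B i j else 0, ?_⟩
  ext i j
  simp only [Matrix.sub_apply, transpose_apply, of_apply]
  rcases lt_trichotomy (e i) (e j) with h | h | h
  · simp [h, h.not_gt]
  · simp [e.injective h, hB.1]
  · simp [h, h.not_gt, hB.2 i j]

theorem IsAlt.congr {B : Matrix ι ι F} (hB : IsAlt B) (Y : Matrix ι κ F) :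
    IsAlt (Yᵀ * B * Y) := by
  obtain ⟨U, rfl⟩ := hB.exists_eq_sub_transpose
  have : Yᵀ * (U - Uᵀ) * Y = (Yᵀ * U * Y) - (Yᵀ * U * Y)ᵀ := by
    simp [Matrix.mul_sub, Matrix.sub_mul, Matrix.mul_assoc]
  rw [this]
  exact IsAlt.sub_transpose _

theorem isAlt_fromBlocks {A : Matrix α α F} {B : Matrix α β F} {C : Matrix β α F}
    {D : Matrix β β F} :
    IsAlt (fromBlocks A B C D) ↔ IsAlt A ∧ C = -Bᵀ ∧ IsAlt D := by
  constructor
  · intro h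
    refine ⟨⟨fun i => h.1 (Sum.inl i), fun i j => h.2 (Sum.inl i) (Sum.inl j)⟩, ?_,
      ⟨fun i => h.1 (Sum.inr i), fun i j => h.2 (Sum.inr i) (Sum.inr j)⟩⟩
    ext i j
    exact h.2 (Sum.inr i) (Sum.inl j)
  · rintro ⟨hA, rfl, hD⟩
    refine ⟨?_, ?_⟩
    · rintro (i | i)
      · exact hA.1 i
      · exact hD.1 i
    · rintro (i | i) (j | j)
      · exact hA.2 i j
      · simp
      · simp
      · exact hD.2 i j

/-- The additive group of alternating matrices. -/
def altSubgroup (ι F : Type*) [Fintype ι] [DecidableEq ι] [Field F] [Fintype F] [DecidableEq F] :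
    AddSubgroup (Matrix ι ι F) where
  carrier := {B | IsAlt B}
  zero_mem' := IsAlt.zero
  add_mem' := IsAlt.add
  neg_mem' := IsAlt.neg

/-- The number of alternating matrices. -/
def altCard (ι F : Type*) [Fintype ι] [DecidableEq ι] [Field F] [Fintype F] [DecidableEq F] : ℕ :=
  Finset.card {B : Matrix ι ι F | IsAlt B}

theorem altCard_congr (e : ι ≃ κ) : altCard ι F = altCard κ F := by
  unfold altCard
  refine Finset.card_equiv (reindex e e) fun B => ?_
  simp only [Finset.mem_filter, Finset.mem_univ, true_and]
  refine ⟨fun h => ⟨fun i => h.1 _, fun i j => h.2 _ _⟩, fun h => ⟨fun i => ?_, fun i j => ?_⟩⟩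
  · simpa using h.1 (e i)
  · simpa using h.2 (e i) (e j)

theorem altCard_sum : altCard (α ⊕ β) F =
    altCard α F * (Fintype.card F ^ (Fintype.card α * Fintype.card β) * altCard β F) := by
  have h1 : ∀ (A : Matrix α α F) (B : Matrix α β F) (D : Matrix β β F),
      (∑ C : Matrix β α F, if IsAlt (fromBlocks A B C D) then 1 else 0) =
      (if IsAlt A then 1 else 0) * (if IsAlt D then 1 else 0) := fun A B D => by
    simp only [isAlt_fromBlocks]
    rw [Finset.sum_eq_single (-Bᵀ)]
    · by_cases hA : IsAlt A <;> by_cases hD : IsAlt D <;> simp [hA, hD]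
    · intro C _ hC
      simp [hC]
    · simp
  unfold altCard
  simp only [Finset.card_filter]
  rw [sum_blocks, Finset.sum_mul]
  refine Finset.sum_congr rfl fun A _ => ?_
  rw [Finset.sum_congr rfl fun B _ => Finset.sum_comm]
  simp only [h1, ← Finset.mul_sum]
  rw [Finset.sum_const, Finset.card_univ, card_matrix]
  simp

theorem altCard_fin (n : ℕ) : altCard (Fin n) F = Fintype.card F ^ n.choose 2 := by
  induction n with
  | zero =>
    have : ∀ B : Matrix (Fin 0) (Fin 0) F, IsAlt B := fun B => ⟨fun i => i.elim0, fun i => i.elim0⟩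
    simp [altCard, this, card_matrix]
  | succ n ih =>
    have h1 : altCard (Fin 1) F = 1 := by
      have : ∀ B : Matrix (Fin 1) (Fin 1) F, IsAlt B ↔ B = 0 := fun B => by
        constructor
        · intro h
          ext i j
          rw [Subsingleton.elim j i]
          exact h.1 i
        · rintro rfl
          exact IsAlt.zero
      exact Finset.card_eq_one.2 ⟨0, by ext B; simp [this]⟩
    rw [altCard_congr (finSumFinEquiv (m := n) (n := 1)).symm, altCard_sum, ih, h1,
      Nat.choose_succ_succ', Nat.choose_one_right]
    simp
    ring

theorem trace_mul_single_sub (M : Matrix ι ι F) (i j : ι) (c : F) :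
    (M * (Matrix.single i j c - Matrix.single j i c)).trace = (M j i - M i j) * c := by
  rw [Matrix.mul_sub, trace_sub, Matrix.trace_mul_single, Matrix.trace_mul_single]
  simp
  ring

theorem trace_mul_isAlt {M B : Matrix ι ι F} (hM : Mᵀ = M) (hB : IsAlt B) :
    (M * B).trace = 0 := by
  obtain ⟨U, rfl⟩ := hB.exists_eq_sub_transpose
  rw [Matrix.mul_sub, trace_sub, ← trace_transpose (M * Uᵀ), transpose_mul, transpose_transpose, hM,
    trace_mul_comm U M, sub_self]

/-- Orthogonality of characters: B ↦ λ(a Tr(MB)) is an additive character of the group of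
alternating matrices, trivial exactly when M is symmetric. -/
theorem sum_lam_isAlt [Algebra (ZMod 2) F] {a : F} (ha : a ≠ 0) (M : Matrix ι ι F) :
    ∑ B : Matrix ι ι F with IsAlt B, lam F (a * (M * B).trace) =
      if Mᵀ = M then (altCard ι F : ℝ) else 0 := by
  split_ifs with hM
  · rw [Finset.sum_congr rfl (g := fun _ => (1 : ℝ))]
    · simp [altCard]
    · intro B hB
      rw [trace_mul_isAlt hM (Finset.mem_filter.1 hB).2]
      simp
  · let φ : AddChar (altSubgroup ι F) ℝ :=
      { toFun := fun B => lam F (a * (M * (B : Matrix ι ι F)).trace)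
        map_zero_eq_one' := by simp
        map_add_eq_mul' := fun B C => by
          simp [mul_add, AddChar.map_add_eq_mul] }
    have hφ : φ ≠ 0 := by
      intro h
      obtain ⟨i, j, hij⟩ : ∃ i j, M j i - M i j ≠ 0 := by
        by_contra! hc
        exact hM (by ext i j; exact sub_eq_zero.1 (hc i j))
      -- The scalar in the test matrix is chosen so that the character takes the value λ(x) there;
      -- triviality would force λ to be trivial.
      refine lam_ne_zero (F := F) (DFunLike.ext _ _ fun x => ?_)
      have hB : IsAlt (Matrix.single i j (a⁻¹ * (M j i - M i j)⁻¹ * x) -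
          Matrix.single j i (a⁻¹ * (M j i - M i j)⁻¹ * x)) := by
        rw [← Matrix.transpose_single]
        exact IsAlt.sub_transpose _
      have := DFunLike.congr_fun h (⟨_, hB⟩ : altSubgroup ι F)
      change lam F (a * (M * (_ - _)).trace) = 1 at this
      rw [trace_mul_single_sub] at this
      rw [AddChar.zero_apply, ← this]
      congr 1
      field_simp
    classical
    have : Fintype (altSubgroup ι F) := Fintype.ofFinite _
    rw [← AddChar.sum_eq_zero_iff_ne_zero.2 hφ]
    exact Finset.sum_subtype _ (p := fun B => B ∈ altSubgroup ι F)
      (fun B => by simp [altSubgroup]) _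

/-! #### Invertible matrices -/

/-- The number of invertible matrices. -/
def glCard (ι F : Type*) [Fintype ι] [DecidableEq ι] [Field F] [Fintype F] [DecidableEq F] : ℕ :=
  Finset.card {A : Matrix ι ι F | A.det ≠ 0}

theorem card_GL : Fintype.card (GL ι F) = glCard ι F := by
  unfold glCard
  refine Finset.card_bij (s := Finset.univ) (fun A _ => (A : Matrix ι ι F)) ?_ ?_ ?_
  · intro A _
    simpa using A.det_ne_zero
  · intro A _ B _ h
    exact Units.ext h
  · intro A hA
    exact ⟨GeneralLinearGroup.mkOfDetNeZero A (by simpa using hA), Finset.mem_univ _, rfl⟩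

theorem glCard_fin (n : ℕ) : (glCard (Fin n) F : ℝ) =
    (Fintype.card F : ℝ) ^ n.choose 2 *
      ∏ j ∈ Finset.range n, ((Fintype.card F : ℝ) ^ (j + 1) - 1) := by
  rw [← card_GL, ← Nat.card_eq_fintype_card, card_GL_field, ← Finset.prod_range
    (fun i => Fintype.card F ^ n - Fintype.card F ^ i)]
  have hq : 1 ≤ Fintype.card F := Fintype.card_pos
  rw [Nat.cast_prod, Nat.choose_two_right, ← Finset.sum_range_id, ← Finset.prod_pow_eq_pow_sum,
    ← Finset.prod_range_reflect (fun j => ((Fintype.card F : ℝ) ^ (j + 1) - 1)),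
    ← Finset.prod_mul_distrib]
  refine Finset.prod_congr rfl fun i hi => ?_
  have hi' := Finset.mem_range.1 hi
  rw [Nat.cast_sub (Nat.pow_le_pow_right hq hi'.le), mul_sub, ← pow_add,
    show i + (n - 1 - i + 1) = n by omega]
  push_cast
  ring

/-! #### Symmetric matrices -/

/-- The number of invertible symmetric matrices. -/
def symCard (ι F : Type*) [Fintype ι] [DecidableEq ι] [Field F] [Fintype F] [DecidableEq F] : ℕ :=
  Finset.card {S : Matrix ι ι F | Sᵀ = S ∧ S.det ≠ 0}

theorem symCard_congr (e : ι ≃ κ) : symCard ι F = symCard κ F := by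
  unfold symCard
  refine Finset.card_equiv (reindex e e) fun S => ?_
  simp only [Finset.mem_filter, Finset.mem_univ, true_and, det_reindex_self, transpose_reindex,
    EmbeddingLike.apply_eq_iff_eq]

theorem sum_symm_blocks (P : Matrix (α ⊕ β) (α ⊕ β) F → Prop) [DecidablePred P] :
    (∑ S : Matrix (α ⊕ β) (α ⊕ β) F, if Sᵀ = S ∧ P S then 1 else 0) =
    ∑ A : Matrix α α F, if Aᵀ = A then
      ∑ B : Matrix α β F, ∑ D : Matrix β β F,
        (if Dᵀ = D ∧ P (fromBlocks A B Bᵀ D) then 1 else 0) else 0 := by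
  rw [sum_blocks]
  refine Finset.sum_congr rfl fun A _ => ?_
  have h : ∀ B : Matrix α β F, (∑ C : Matrix β α F, ∑ D : Matrix β β F,
      if (fromBlocks A B C D)ᵀ = fromBlocks A B C D ∧ P (fromBlocks A B C D) then 1 else 0) =
      if Aᵀ = A then ∑ D : Matrix β β F,
        (if Dᵀ = D ∧ P (fromBlocks A B Bᵀ D) then 1 else 0) else 0 := fun B => by
    have hs : ∀ C D, (fromBlocks A B C D)ᵀ = fromBlocks A B C D ↔ Aᵀ = A ∧ C = Bᵀ ∧ Dᵀ = D := by
      intro C D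
      refine isSymm_fromBlocks_iff.trans ⟨fun h => ⟨h.1, h.2.1.symm, h.2.2.2⟩, fun h => ?_⟩
      exact ⟨h.1, h.2.1.symm, by rw [h.2.1, transpose_transpose], h.2.2⟩
    simp only [hs]
    rw [Finset.sum_eq_single Bᵀ]
    · by_cases hA : Aᵀ = A <;> simp [hA]
    · intro C _ hC
      simp [hC]
    · simp
  rw [Finset.sum_congr rfl fun B _ => h B]
  split_ifs <;> simp

/-- The Schur complement D - BᵀA⁻¹B is a translate of D by a symmetric matrix, and its determinant
times that of A is the full determinant. -/
theorem sum_symm_schur {A : Matrix α α F} (hA : Aᵀ = A) (hdet : A.det ≠ 0) (B : Matrix α β F) :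
    (∑ D : Matrix β β F, if Dᵀ = D ∧ (fromBlocks A B Bᵀ D).det ≠ 0 then 1 else 0) =
      symCard β F := by
  have : Invertible A := A.invertibleOfIsUnitDet (isUnit_iff_ne_zero.2 hdet)
  have hE : (Bᵀ * ⅟A * B)ᵀ = Bᵀ * ⅟A * B := by
    rw [invOf_eq_nonsing_inv, transpose_mul, transpose_mul, transpose_nonsing_inv, hA,
      transpose_transpose, Matrix.mul_assoc]
  unfold symCard
  rw [Finset.card_filter]
  refine Fintype.sum_equiv (Equiv.subRight (Bᵀ * ⅟A * B)) _ _ fun D => ?_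
  rw [det_fromBlocks₁₁]
  simp only [Equiv.subRight_apply, transpose_sub, hE, sub_left_inj, ne_eq, mul_eq_zero, hdet,
    false_or]

theorem exists_det_ne_zero_mul_eq {v : Matrix Unit ι F} (hv : v ≠ 0) (i₀ : ι) :
    ∃ g : Matrix ι ι F, g.det ≠ 0 ∧ (Matrix.single () i₀ 1 : Matrix Unit ι F) * g = v := by
  obtain ⟨j, hj⟩ : ∃ j, v () j ≠ 0 := by
    by_contra! hc
    exact hv (by ext u j; exact hc j)
  -- The identity with row j replaced by v has determinant v_j ≠ 0; exchanging rows i₀ and j puts v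
  -- in row i₀.
  refine ⟨((1 : Matrix ι ι F).updateRow j (v ())).submatrix (Equiv.swap i₀ j) id, ?_, ?_⟩
  · rw [det_permute, ← cramer_transpose_apply]
    rcases Int.units_eq_one_or (Equiv.Perm.sign (Equiv.swap i₀ j)) with h | h <;>
      simpa [h] using hj
  · ext u k
    simp

/-- Congruence by diag(1, g) changes the border but neither symmetry nor invertibility, so the count
is the same for all nonzero borders. -/
theorem sum_symm_border_congr {v w : Matrix α β F} {g : Matrix β β F} (hg : g.det ≠ 0)
    (h : w * g = v) (A : Matrix α α F) :
    (∑ D : Matrix β β F, if Dᵀ = D ∧ (fromBlocks A v vᵀ D).det ≠ 0 then 1 else 0) =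
      ∑ D : Matrix β β F, if Dᵀ = D ∧ (fromBlocks A w wᵀ D).det ≠ 0 then 1 else 0 := by
  have hu : IsUnit g.det := isUnit_iff_ne_zero.2 hg
  have hu' : IsUnit gᵀ.det := by rwa [det_transpose]
  let e : Matrix β β F ≃ Matrix β β F :=
    { toFun := fun D => gᵀ * D * g
      invFun := fun D => gᵀ⁻¹ * D * g⁻¹
      left_inv := fun D => by
        simp only [Matrix.mul_assoc, mul_nonsing_inv _ hu, Matrix.mul_one]
        rw [nonsing_inv_mul_cancel_left _ _ hu']
      right_inv := fun D => by
        simp only [Matrix.mul_assoc, nonsing_inv_mul _ hu, Matrix.mul_one]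
        rw [mul_nonsing_inv_cancel_left _ _ hu'] }
  refine (Fintype.sum_equiv e _ _ fun D => ?_).symm
  have h1 : (e D)ᵀ = e D ↔ Dᵀ = D := by
    have : (e D)ᵀ = e Dᵀ := by simp [e, Matrix.mul_assoc]
    rw [this, e.apply_eq_iff_eq]
  have h2 : fromBlocks A v vᵀ (e D) =
      (fromBlocks 1 0 0 g)ᵀ * fromBlocks A w wᵀ D * fromBlocks 1 0 0 g := by
    rw [fromBlocks_transpose, fromBlocks_multiply, fromBlocks_multiply, ← h]
    simp [e]
  simp only [h1, h2]
  simp [hg]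

/-- After reassociating the indices, the leading 2 × 2 block has rows (0, 1), (1, y). It is
invertible for every y, so its Schur complement leaves a free invertible symmetric matrix, whatever
y and u are. -/
theorem sum_symm_border_single (y : Matrix Unit Unit F) (u : Matrix Unit β F) :
    (∑ D : Matrix β β F, if Dᵀ = D ∧ (fromBlocks (0 : Matrix Unit Unit F)
        (Matrix.single () (Sum.inl ()) 1) (Matrix.single () (Sum.inl ()) 1)ᵀ
        (fromBlocks y u uᵀ D)).det ≠ 0 then 1 else 0) = symCard β F := by
  rw [← sum_symm_schur (A := (fromBlocks 0 1 1 y : Matrix (Unit ⊕ Unit) (Unit ⊕ Unit) F))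
    (B := fromRows 0 u)]
  · refine Finset.sum_congr rfl fun D _ => ?_
    congr 3
    rw [← det_reindex_self (Equiv.sumAssoc Unit Unit β)]
    congr 3
    ext (i | i | i) (j | j | j) <;> simp
  · rw [fromBlocks_transpose]
    ext (i | i) (j | j) <;> simp
  · have h : (fromBlocks 0 1 1 y : Matrix (Unit ⊕ Unit) (Unit ⊕ Unit) F) * fromBlocks (-y) 1 1 0 =
        1 := by
      rw [fromBlocks_multiply, ← fromBlocks_one]
      simp
    have := congrArg Matrix.det h
    rw [det_mul, det_one] at this
    exact left_ne_zero_of_mul_eq_one this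

theorem symCard_zero : symCard (Fin 0) F = 1 := by
  unfold symCard
  rw [Finset.filter_true_of_mem, Finset.card_univ, card_matrix]
  · simp
  · intro S _
    exact ⟨by ext i; exact i.elim0, by simp⟩

theorem symCard_one : symCard (Fin 1) F = Fintype.card F - 1 := by
  rw [← Fintype.card_units]
  unfold symCard
  symm
  refine Finset.card_bij (s := Finset.univ) (fun x _ => Matrix.of fun _ _ => (x : F)) ?_ ?_ ?_
  · intro x _
    simp only [Finset.mem_filter, Finset.mem_univ, true_and]
    exact ⟨by ext; rfl, by simp⟩
  · intro x _ y _ h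
    exact Units.ext (congrFun (congrFun h 0) 0)
  · intro S hS
    simp only [Finset.mem_filter, Finset.mem_univ, true_and, det_fin_one] at hS
    refine ⟨Units.mk0 _ hS.2, Finset.mem_univ _, ?_⟩
    ext i j
    rw [Subsingleton.elim i 0, Subsingleton.elim j 0]
    rfl

/-- The corner entry decides. If it is nonzero, the Schur complement has size n + 1 and the border
is free. If it is zero, a zero border gives a singular matrix, and each nonzero border can be moved
to a unit vector, which leaves size n. -/
theorem symCard_succ_succ (n : ℕ) : symCard (Fin (n + 2)) F =
    (Fintype.card F - 1) * Fintype.card F ^ (n + 1) * symCard (Fin (n + 1)) F +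
    (Fintype.card F ^ (n + 1) - 1) * Fintype.card F ^ (n + 1) * symCard (Fin n) F := by
  let e : Fin (n + 2) ≃ Unit ⊕ (Unit ⊕ Fin n) := Fintype.equivOfCardEq (by simp; ring)
  let e' : Fin (n + 1) ≃ Unit ⊕ Fin n := Fintype.equivOfCardEq (by simp; ring)
  have hy : ∀ v : Matrix Unit (Unit ⊕ Fin n) F, v ≠ 0 →
      (∑ D, if Dᵀ = D ∧ (fromBlocks (0 : Matrix Unit Unit F) v vᵀ D).det ≠ 0 then 1 else 0) =
      Fintype.card F ^ (n + 1) * symCard (Fin n) F := by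
    intro v hv
    obtain ⟨g, hg, h⟩ := exists_det_ne_zero_mul_eq hv (Sum.inl ())
    rw [sum_symm_border_congr hg h, sum_symm_blocks (fun D => (fromBlocks _ _ _ D).det ≠ 0)]
    have hs : ∀ y : Matrix Unit Unit F, yᵀ = y := fun y => by ext i j; rfl
    simp only [hs, if_true, sum_symm_border_single]
    simp [card_matrix]
    ring
  have h0 : (∑ D : Matrix (Unit ⊕ Fin n) (Unit ⊕ Fin n) F,
      if Dᵀ = D ∧ (fromBlocks (0 : Matrix Unit Unit F) 0 0ᵀ D).det ≠ 0 then 1 else 0) = 0 :=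
    Finset.sum_eq_zero fun D _ => by simp
  rw [symCard_congr e, symCard_congr (F := F) e']
  conv_lhs => rw [symCard]
  rw [Finset.card_filter, sum_symm_blocks (fun S => S.det ≠ 0)]
  have hs : ∀ A : Matrix Unit Unit F, Aᵀ = A := fun A => by ext i j; rfl
  simp only [hs, if_true]
  rw [← Finset.sum_erase_add _ _ (Finset.mem_univ (0 : Matrix Unit Unit F)),
    Finset.sum_congr rfl (g := fun _ =>
      Fintype.card F ^ (n + 1) * symCard (Unit ⊕ Fin n) F)]
  · rw [← Finset.sum_erase_add _ _ (Finset.mem_univ (0 : Matrix Unit (Unit ⊕ Fin n) F)), h0,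
      Finset.sum_congr rfl (fun v hv => hy v (Finset.ne_of_mem_erase hv)), Finset.sum_const,
      Finset.sum_const, Finset.card_erase_of_mem (Finset.mem_univ _),
      Finset.card_erase_of_mem (Finset.mem_univ _), Finset.card_univ, Finset.card_univ, card_matrix,
      card_matrix]
    simp [add_comm 1 n, mul_assoc]
  · intro A hA
    have hdet : A.det ≠ 0 := fun h => Finset.ne_of_mem_erase hA (by
      ext i j
      simpa [det_unique] using h)
    rw [Finset.sum_congr rfl fun B _ => sum_symm_schur (hs A) hdet B]
    simp [card_matrix, add_comm 1 n]

theorem oddProd_succ (q m : ℕ) :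
    oddProd q (m + 1) = oddProd q m * ((q : ℝ) ^ (2 * m + 1) - 1) := by
  unfold oddProd
  rw [Finset.prod_Icc_succ_top (by omega)]
  rfl

/-- The recurrence has order two, so both parities are carried through one induction. -/
theorem symCard_even_odd (m : ℕ) :
    (symCard (Fin (2 * m)) F : ℝ) =
        (Fintype.card F : ℝ) ^ (m * (m + 1)) * oddProd (Fintype.card F) m ∧
      (symCard (Fin (2 * m + 1)) F : ℝ) =
        (Fintype.card F : ℝ) ^ (m * (m + 1)) * oddProd (Fintype.card F) (m + 1) := by
  have hq : 1 ≤ Fintype.card F := Fintype.card_pos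
  have hrec : ∀ n, (symCard (Fin (n + 2)) F : ℝ) =
      ((Fintype.card F : ℝ) - 1) * (Fintype.card F : ℝ) ^ (n + 1) * symCard (Fin (n + 1)) F +
      ((Fintype.card F : ℝ) ^ (n + 1) - 1) * (Fintype.card F : ℝ) ^ (n + 1) *
        symCard (Fin n) F := fun n => by
    rw [symCard_succ_succ]
    push_cast [Nat.cast_sub hq, Nat.cast_sub (Nat.one_le_pow (n + 1) _ hq)]
    rfl
  induction m with
  | zero =>
    rw [Nat.mul_zero, Nat.zero_add, symCard_zero, symCard_one, oddProd_succ]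
    simp [oddProd, Nat.cast_sub hq]
  | succ m ih =>
    have h1 : (symCard (Fin (2 * (m + 1))) F : ℝ) =
        (Fintype.card F : ℝ) ^ ((m + 1) * (m + 1 + 1)) * oddProd (Fintype.card F) (m + 1) := by
      rw [show 2 * (m + 1) = 2 * m + 2 by ring, hrec, ih.1, ih.2, oddProd_succ]
      ring
    refine ⟨h1, ?_⟩
    rw [show 2 * (m + 1) + 1 = (2 * m + 1) + 2 by ring, hrec, ih.2,
      show 2 * m + 1 + 1 = 2 * (m + 1) by ring, h1, oddProd_succ _ (m + 1)]
    ring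

end Counting

/-! ### Sums over double cosets -/

/-- The fibre over x₀sy₀ consists of the pairs (x₀x, s x⁻¹ s y₀) with x and sxs in P. Square
matrices form only a monoid, so inverses are supplied on P alone. -/
theorem card_mul_sum_doubleCoset {M : Type*} [Monoid M] [DecidableEq M] {P : Finset M} {s : M}
    (hs : s * s = 1) (hmul : ∀ x ∈ P, ∀ y ∈ P, x * y ∈ P) (inv : M → M)
    (hinv : ∀ x ∈ P, inv x ∈ P) (hxi : ∀ x ∈ P, x * inv x = 1) (hix : ∀ x ∈ P, inv x * x = 1)
    (f : M → ℝ) :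
    (Finset.card {x ∈ P | s * x * s ∈ P} : ℝ) *
        ∑ w ∈ (P ×ˢ P).image (fun x => x.1 * s * x.2), f w =
      ∑ x ∈ P, ∑ y ∈ P, f (x * s * y) := by
  rw [← Finset.sum_product' (f := fun x y => f (x * s * y)), Finset.mul_sum,
    ← Finset.sum_fiberwise_of_maps_to 
      (fun x hx => Finset.mem_image_of_mem (fun x : M × M => x.1 * s * x.2) hx)]
  refine Finset.sum_congr rfl fun w hw => ?_
  obtain ⟨⟨x₀, y₀⟩, h₀, rfl⟩ := Finset.mem_image.1 hw
  obtain ⟨hx₀, hy₀⟩ := Finset.mem_product.1 h₀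
  dsimp only at hx₀ hy₀ ⊢
  rw [Finset.sum_congr rfl (g := fun _ => f (x₀ * s * y₀))
    (fun x hx => by rw [(Finset.mem_filter.1 hx).2]), Finset.sum_const, nsmul_eq_mul]
  congr 2
  have hss : ∀ z, s * (s * z) = z := fun z => by rw [← mul_assoc, hs, one_mul]
  have hxi' : ∀ x ∈ P, ∀ z, x * (inv x * z) = z := fun x hx z => by
    rw [← mul_assoc, hxi x hx, one_mul]
  have hix' : ∀ x ∈ P, ∀ z, inv x * (x * z) = z := fun x hx z => by
    rw [← mul_assoc, hix x hx, one_mul]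
  refine Finset.card_bij (fun x _ => (x₀ * x, s * inv x * s * y₀)) ?_ ?_ ?_
  · intro x hx
    obtain ⟨hx, hsx⟩ := Finset.mem_filter.1 hx
    refine Finset.mem_filter.2 ⟨Finset.mem_product.2 ⟨hmul _ hx₀ _ hx, hmul _ ?_ _ hy₀⟩, ?_⟩
    · have : s * inv x * s = inv (s * x * s) := by
        rw [← hix' _ hsx (s * inv x * s)]
        simp only [mul_assoc, hss, hxi' x hx, hs, mul_one]
      rw [this]
      exact hinv _ hsx
    · simp only [mul_assoc, hss, hxi' x hx]
  · intro x hx y hy h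
    have := (Prod.mk.inj h).1
    rw [← hix' x₀ hx₀ x, this, hix' x₀ hx₀]
  · rintro ⟨x, y⟩ hxy
    obtain ⟨hxy, h⟩ := Finset.mem_filter.1 hxy
    obtain ⟨hx, hy⟩ := Finset.mem_product.1 hxy
    dsimp only at hx hy h
    have hz := hmul _ (hinv _ hx₀) _ hx
    have h1 : inv x₀ * x * (s * y) = s * y₀ := by
      rw [← hix' x₀ hx₀ (s * y₀), ← mul_assoc x₀, ← h]
      simp only [mul_assoc]
    refine ⟨inv x₀ * x, Finset.mem_filter.2 ⟨hz, ?_⟩, ?_⟩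
    · have : s * (inv x₀ * x) * s = y₀ * inv y := by
        rw [← hss y₀, ← h1]
        simp only [mul_assoc, hxi y hy, mul_one]
      rw [this]
      exact hmul _ hy₀ _ (hinv _ hy)
    · refine Prod.ext (hxi' x₀ hx₀ x) ?_
      dsimp only
      rw [mul_assoc, mul_assoc, ← h1, hix' _ hz, hss]

/-! ### The parabolic subgroup, its intersection with its conjugate by σ, and the collapsed
character sum. -/

section Parabolic

variable {F : Type*} [Field F] [Fintype F] [DecidableEq F]
variable {ι κ α β : Type*} [Fintype ι] [DecidableEq ι] [Fintype κ] [DecidableEq κ]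
  [Fintype α] [DecidableEq α] [Fintype β] [DecidableEq β]

/-- The element of the parabolic subgroup with Levi part `A` and unipotent part `B`. -/
def parMat (A B : Matrix ι ι F) : Matrix (ι ⊕ ι) (ι ⊕ ι) F :=
  fromBlocks A (A * B) 0 (A⁻¹)ᵀ

/-- The pairs parametrizing the parabolic subgroup. -/
def parPairs (ι F : Type*) [Fintype ι] [DecidableEq ι] [Field F] [Fintype F] [DecidableEq F] :
    Finset (Matrix ι ι F × Matrix ι ι F) :=
  Finset.univ.filter (fun A => A.det ≠ 0) ×ˢ Finset.univ.filter (fun B => IsAlt B)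

/-- The parabolic subgroup, over an arbitrary index type. -/
def parFinset (ι F : Type*) [Fintype ι] [DecidableEq ι] [Field F] [Fintype F] [DecidableEq F] :
    Finset (Matrix (ι ⊕ ι) (ι ⊕ ι) F) :=
  (parPairs ι F).image fun x => parMat x.1 x.2

theorem mem_parPairs {x : Matrix ι ι F × Matrix ι ι F} :
    x ∈ parPairs ι F ↔ x.1.det ≠ 0 ∧ IsAlt x.2 := by
  simp [parPairs]

theorem mem_parFinset {X : Matrix (ι ⊕ ι) (ι ⊕ ι) F} :
    X ∈ parFinset ι F ↔ ∃ A B, A.det ≠ 0 ∧ IsAlt B ∧ parMat A B = X := by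
  simp [parFinset, mem_parPairs, and_assoc]

theorem parMat_injOn :
    Set.InjOn (fun x : Matrix ι ι F × Matrix ι ι F => parMat x.1 x.2) (parPairs ι F) := by
  rintro ⟨A, B⟩ hx ⟨A', B'⟩ _ h
  obtain ⟨hA, -⟩ := mem_parPairs.1 hx
  obtain ⟨h1, h2, -, -⟩ := fromBlocks_inj.1 h
  dsimp only at h1 h2 hA
  subst h1
  have hu : IsUnit A.det := isUnit_iff_ne_zero.2 hA
  rw [← nonsing_inv_mul_cancel_left A B hu, h2, nonsing_inv_mul_cancel_left A B' hu]

theorem card_parFinset : (parFinset ι F).card = glCard ι F * altCard ι F := by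
  rw [parFinset, Finset.card_image_of_injOn parMat_injOn, parPairs, Finset.card_product]
  rfl

theorem parMat_mul {A A' : Matrix ι ι F} (hA' : A'.det ≠ 0) (B B' : Matrix ι ι F) :
    parMat A B * parMat A' B' = parMat (A * A') (B' + A'⁻¹ * B * (A'⁻¹)ᵀ) := by
  have hu : IsUnit A'.det := isUnit_iff_ne_zero.2 hA'
  unfold parMat
  rw [fromBlocks_multiply]
  simp only [Matrix.mul_zero, Matrix.zero_mul, add_zero, zero_add]
  congr 1
  · rw [Matrix.mul_add]
    simp only [Matrix.mul_assoc]
    rw [mul_nonsing_inv_cancel_left _ _ hu]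
  · rw [Matrix.mul_inv_rev, transpose_mul]

theorem parMat_one_zero : parMat (1 : Matrix ι ι F) 0 = 1 := by
  simp [parMat]

theorem parFinset_mul {X Y : Matrix (ι ⊕ ι) (ι ⊕ ι) F} (hX : X ∈ parFinset ι F)
    (hY : Y ∈ parFinset ι F) : X * Y ∈ parFinset ι F := by
  obtain ⟨A, B, hA, hB, rfl⟩ := mem_parFinset.1 hX
  obtain ⟨A', B', hA', hB', rfl⟩ := mem_parFinset.1 hY
  rw [parMat_mul hA']
  refine mem_parFinset.2 ⟨_, _, by simp [hA, hA'], hB'.add ?_, rfl⟩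
  simpa using hB.congr (A'⁻¹)ᵀ

theorem parMat_mul_inv {A B : Matrix ι ι F} (hA : A.det ≠ 0) :
    parMat A⁻¹ (-(A * B * Aᵀ)) * parMat A B = 1 := by
  have hu : IsUnit A.det := isUnit_iff_ne_zero.2 hA
  rw [parMat_mul hA, nonsing_inv_mul _ hu, ← parMat_one_zero]
  congr 1
  have : A⁻¹ * (A * B * Aᵀ) * (A⁻¹)ᵀ = B := by
    simp only [Matrix.mul_assoc]
    rw [nonsing_inv_mul_cancel_left _ _ hu, ← transpose_mul, nonsing_inv_mul _ hu, transpose_one,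
      Matrix.mul_one]
  rw [Matrix.mul_neg, Matrix.neg_mul, this, add_neg_cancel]

theorem parFinset_inv {X : Matrix (ι ⊕ ι) (ι ⊕ ι) F} (hX : X ∈ parFinset ι F) :
    X⁻¹ ∈ parFinset ι F ∧ X * X⁻¹ = 1 ∧ X⁻¹ * X = 1 := by
  obtain ⟨A, B, hA, hB, rfl⟩ := mem_parFinset.1 hX
  have h := parMat_mul_inv (B := B) hA
  have hi := inv_eq_left_inv h
  refine ⟨?_, ?_, ?_⟩
  · rw [hi]
    refine mem_parFinset.2 ⟨_, _, ?_, ?_, rfl⟩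
    · rw [det_nonsing_inv, Ring.inverse_eq_inv']
      exact inv_ne_zero hA
    · simpa using (hB.congr Aᵀ).neg
  · rw [hi]
    exact mul_eq_one_comm.1 h
  · rw [hi]
    exact h

/-- The matrix of the bilinear form `x, y ↦ ∑ x_i y_{n+i}`. -/
def hypMat (ι F : Type*) [DecidableEq ι] [Field F] : Matrix (ι ⊕ ι) (ι ⊕ ι) F :=
  fromBlocks 0 1 0 0

/-- Matrices preserving the hyperbolic quadratic form. -/
def IsOrtho (X : Matrix (ι ⊕ ι) (ι ⊕ ι) F) : Prop :=
  IsAlt (Xᵀ * hypMat ι F * X - hypMat ι F)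

theorem IsOrtho.mul {X Y : Matrix (ι ⊕ ι) (ι ⊕ ι) F} (hX : IsOrtho X) (hY : IsOrtho Y) :
    IsOrtho (X * Y) := by
  have h := (IsAlt.congr hX Y).add hY
  unfold IsOrtho
  convert h using 1
  rw [transpose_mul, Matrix.mul_sub, Matrix.sub_mul]
  simp only [Matrix.mul_assoc]
  abel

theorem isOrtho_upper_iff (A C E : Matrix ι ι F) :
    IsOrtho (fromBlocks A C 0 E) ↔ Aᵀ * E = 1 ∧ IsAlt (Cᵀ * E) := by
  have h : (fromBlocks A C 0 E)ᵀ * hypMat ι F * fromBlocks A C 0 E - hypMat ι F =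
      fromBlocks 0 (Aᵀ * E - 1) 0 (Cᵀ * E) := by
    rw [hypMat, fromBlocks_transpose, fromBlocks_multiply, fromBlocks_multiply, sub_eq_add_neg,
      fromBlocks_neg, fromBlocks_add]
    simp [sub_eq_add_neg]
  unfold IsOrtho
  rw [h, isAlt_fromBlocks]
  constructor
  · rintro ⟨-, h1, h2⟩
    refine ⟨?_, h2⟩
    rw [zero_eq_neg, transpose_eq_zero, sub_eq_zero] at h1
    exact h1
  · rintro ⟨h1, h2⟩
    exact ⟨IsAlt.zero, by simp [h1], h2⟩

/-- P is the stabilizer, in the orthogonal group, of the span of the first n coordinates. Membership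
of an orthogonal matrix can thus be read off one block. -/
theorem mem_parFinset_iff {X : Matrix (ι ⊕ ι) (ι ⊕ ι) F} :
    X ∈ parFinset ι F ↔ IsOrtho X ∧ X.toBlocks₂₁ = 0 := by
  rw [mem_parFinset]
  constructor
  · rintro ⟨A, B, hA, hB, rfl⟩
    have hu : IsUnit A.det := isUnit_iff_ne_zero.2 hA
    refine ⟨(isOrtho_upper_iff _ _ _).2 ⟨?_, ?_⟩, by simp [parMat]⟩
    · rw [← transpose_mul, nonsing_inv_mul _ hu, transpose_one]
    · rw [transpose_mul, Matrix.mul_assoc, ← transpose_mul, nonsing_inv_mul _ hu, transpose_one,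
        Matrix.mul_one]
      obtain ⟨U, rfl⟩ := hB.exists_eq_sub_transpose
      rw [transpose_sub]
      exact IsAlt.sub_transpose _
  · rintro ⟨hX, h0⟩
    rw [← fromBlocks_toBlocks X, h0] at hX ⊢
    generalize X.toBlocks₁₁ = A at hX ⊢
    generalize X.toBlocks₁₂ = C at hX ⊢
    generalize X.toBlocks₂₂ = E at hX ⊢
    obtain ⟨h1, h2⟩ := (isOrtho_upper_iff _ _ _).1 hX
    have h3 : Eᵀ * A = 1 := by rw [← transpose_transpose A, ← transpose_mul, h1, transpose_one]
    have hi : A⁻¹ = Eᵀ := inv_eq_left_inv h3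
    refine ⟨A, Eᵀ * C, ?_, ?_, ?_⟩
    · intro h
      have := congrArg det h3
      rw [det_mul, h, mul_zero, det_one] at this
      exact zero_ne_one this
    · obtain ⟨U, hU⟩ := h2.exists_eq_sub_transpose
      have : Eᵀ * C = Uᵀ - Uᵀᵀ := by
        rw [← transpose_sub, ← hU, transpose_mul, transpose_transpose]
      rw [this]
      exact IsAlt.sub_transpose _
    · rw [parMat, hi, ← Matrix.mul_assoc, mul_eq_one_comm.1 h3, Matrix.one_mul,
        transpose_transpose]

theorem trace_fromBlocks_eq (A : Matrix α α F) (B : Matrix α β F) (C : Matrix β α F)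
    (D : Matrix β β F) : (fromBlocks A B C D).trace = A.trace + D.trace := by
  simp [Matrix.trace, Fintype.sum_sum_type]

/-- The involution attached to a symmetric idempotent matrix. -/
def swapMat (D : Matrix ι ι F) : Matrix (ι ⊕ ι) (ι ⊕ ι) F :=
  fromBlocks (1 - D) D D (1 - D)

section Swap

variable {D : Matrix ι ι F}

theorem swapMat_mul_self (hD : D * D = D) : swapMat D * swapMat D = 1 := by
  rw [swapMat, fromBlocks_multiply, ← fromBlocks_one]
  simp [Matrix.mul_sub, Matrix.sub_mul, hD]

theorem isOrtho_swapMat (hD : D * D = D) (hD' : Dᵀ = D) : IsOrtho (swapMat D) := by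
  have : (swapMat D)ᵀ * hypMat ι F * swapMat D - hypMat ι F = fromBlocks 0 (-D) D 0 := by
    rw [swapMat, hypMat, fromBlocks_transpose, fromBlocks_multiply, fromBlocks_multiply,
      sub_eq_add_neg (fromBlocks _ _ _ _), fromBlocks_neg, fromBlocks_add]
    simp [Matrix.mul_sub, Matrix.sub_mul, hD, hD', ← sub_eq_add_neg]
  rw [IsOrtho, this, isAlt_fromBlocks]
  exact ⟨IsAlt.zero, by simp [hD'], IsAlt.zero⟩

theorem swapMat_conj_mem_iff (hD : D * D = D) (hD' : Dᵀ = D) {A B : Matrix ι ι F}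
    (hA : A.det ≠ 0) (hB : IsAlt B) :
    swapMat D * parMat A B * swapMat D ∈ parFinset ι F ↔
      D * A * (1 - D) + D * A * B * D + (1 - D) * (A⁻¹)ᵀ * D = 0 := by
  have h1 := isOrtho_swapMat hD hD'
  have h2 := (mem_parFinset_iff.1 (mem_parFinset.2 ⟨A, B, hA, hB, rfl⟩)).1
  rw [mem_parFinset_iff, and_iff_right ((h1.mul h2).mul h1), swapMat, parMat, fromBlocks_multiply,
    fromBlocks_multiply, toBlocks_fromBlocks₂₁]
  simp only [Matrix.mul_zero, add_zero, Matrix.add_mul, Matrix.mul_assoc, add_assoc]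

/-- The number of elements of the parabolic subgroup that the involution conjugates back into the
parabolic subgroup. -/
def stabCard (D : Matrix ι ι F) : ℕ :=
  Finset.card {x ∈ parPairs ι F |
    D * x.1 * (1 - D) + D * x.1 * x.2 * D + (1 - D) * (x.1⁻¹)ᵀ * D = 0}

theorem card_filter_conj_mem (hD : D * D = D) (hD' : Dᵀ = D) :
    Finset.card {X ∈ parFinset ι F | swapMat D * X * swapMat D ∈ parFinset ι F} = stabCard D := by
  rw [parFinset, Finset.filter_image, Finset.card_image_of_injOn
    (parMat_injOn.mono (Finset.coe_subset.2 (Finset.filter_subset _ _))), stabCard]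
  congr 1
  refine Finset.filter_congr fun x hx => ?_
  obtain ⟨h1, h2⟩ := mem_parPairs.1 hx
  exact swapMat_conj_mem_iff hD hD' h1 h2

/-- The double coset of the involution, as a finset. -/
def cosetFinset (D : Matrix ι ι F) : Finset (Matrix (ι ⊕ ι) (ι ⊕ ι) F) :=
  (parFinset ι F ×ˢ parFinset ι F).image fun x => x.1 * swapMat D * x.2

/-- By cyclicity Tr(XσY) = Tr(YXσ), and X ↦ YX permutes P, so the sum over Y contributes only the
factor |P|. -/
theorem stabCard_mul_sum (hD : D * D = D) (hD' : Dᵀ = D) (φ : F → ℝ) :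
    (stabCard D : ℝ) * ∑ w ∈ cosetFinset D, φ w.trace =
      (glCard ι F * altCard ι F : ℝ) *
        ∑ x ∈ parPairs ι F, φ ((x.1 * (1 - D)).trace + (D * x.1 * x.2).trace +
          (x.1⁻¹ * (1 - D)).trace) := by
  rw [← card_filter_conj_mem hD hD', cosetFinset,
    card_mul_sum_doubleCoset (swapMat_mul_self hD) (fun X hX Y hY => parFinset_mul hX hY)
      (fun X => X⁻¹) (fun X hX => (parFinset_inv hX).1) (fun X hX => (parFinset_inv hX).2.1)
      (fun X hX => (parFinset_inv hX).2.2) (fun w => φ w.trace),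
    Finset.sum_comm, ← Nat.cast_mul, ← card_parFinset, ← nsmul_eq_mul, ← Finset.sum_const]
  refine Finset.sum_congr rfl fun Y hY => ?_
  have h1 : ∑ X ∈ parFinset ι F, φ (X * swapMat D * Y).trace =
      ∑ X ∈ parFinset ι F, φ (X * swapMat D).trace := by
    refine Finset.sum_bij' (fun X _ => Y * X) (fun X _ => Y⁻¹ * X)
      (fun X hX => parFinset_mul hY hX) (fun X hX => parFinset_mul (parFinset_inv hY).1 hX) ?_ ?_ ?_
    · intro X _
      rw [← Matrix.mul_assoc, (parFinset_inv hY).2.2, Matrix.one_mul]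
    · intro X _
      rw [← Matrix.mul_assoc, (parFinset_inv hY).2.1, Matrix.one_mul]
    · intro X _
      rw [trace_mul_comm, Matrix.mul_assoc]
  rw [h1, parFinset, Finset.sum_image parMat_injOn]
  refine Finset.sum_congr rfl fun x _ => ?_
  rw [parMat, swapMat, fromBlocks_multiply, trace_fromBlocks_eq]
  simp only [Matrix.zero_mul, zero_add]
  rw [trace_add, trace_mul_comm (x.1 * x.2) D, Matrix.mul_assoc D, ← trace_transpose ((x.1⁻¹)ᵀ * _),
    transpose_mul, transpose_transpose, transpose_sub, transpose_one, hD',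
    trace_mul_comm (1 - D)]

variable [Algebra (ZMod 2) F]

/-- The character sum over the Levi part of the parabolic subgroup. -/
def leviSum (D : Matrix ι ι F) (a : F) : ℝ :=
  ∑ A : Matrix ι ι F, if A.det ≠ 0 ∧ (D * A)ᵀ = D * A then
    lam F (a * ((A * (1 - D)).trace + (A⁻¹ * (1 - D)).trace)) else 0

theorem sum_parPairs_lam {a : F} (ha : a ≠ 0) (D : Matrix ι ι F) :
    ∑ x ∈ parPairs ι F, lam F (a * ((x.1 * (1 - D)).trace + (D * x.1 * x.2).trace +
      (x.1⁻¹ * (1 - D)).trace)) = altCard ι F * leviSum D a := by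
  rw [parPairs, Finset.sum_product, Finset.sum_filter, leviSum, Finset.mul_sum]
  refine Finset.sum_congr rfl fun A _ => ?_
  by_cases hA : A.det = 0
  · simp [hA]
  simp only [ne_eq, hA, not_false_eq_true, if_true, true_and]
  rw [Finset.sum_congr rfl (g := fun B : Matrix ι ι F =>
    lam F (a * ((A * (1 - D)).trace + (A⁻¹ * (1 - D)).trace)) * lam F (a * (D * A * B).trace))]
  · rw [← Finset.mul_sum, sum_lam_isAlt ha]
    split_ifs <;> ring
  · intro B _
    rw [← AddChar.map_add_eq_mul]
    congr 1
    ring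

end Swap

/-! ### Block coordinates adapted to the projection D. -/

theorem reindex_mul_reindex (e : ι ≃ κ) (A B : Matrix ι ι F) :
    reindex e e A * reindex e e B = reindex e e (A * B) := by
  simp only [reindex_apply, submatrix_mul_equiv]

theorem one_sub_reindex (e : ι ≃ κ) (D : Matrix ι ι F) :
    1 - reindex e e D = reindex e e (1 - D) := by
  simp [submatrix_sub]

theorem trace_reindex_self (e : ι ≃ κ) (A : Matrix ι ι F) :
    (reindex e e A).trace = A.trace := by
  simp only [Matrix.trace, diag_apply, reindex_apply, submatrix_apply]
  exact e.symm.sum_comp fun i => A i i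

theorem isAlt_reindex (e : ι ≃ κ) (B : Matrix ι ι F) : IsAlt (reindex e e B) ↔ IsAlt B := by
  refine ⟨fun h => ⟨fun i => ?_, fun i j => ?_⟩, fun h => ⟨fun i => h.1 _, fun i j => h.2 _ _⟩⟩
  · simpa using h.1 (e i)
  · simpa using h.2 (e i) (e j)

theorem stabCard_reindex (e : ι ≃ κ) (D : Matrix ι ι F) :
    stabCard (reindex e e D) = stabCard D := by
  symm
  unfold stabCard
  refine Finset.card_equiv ((reindex e e).prodCongr (reindex e e)) fun x => ?_
  simp only [Finset.mem_filter, mem_parPairs, Equiv.prodCongr_apply, Prod.map_fst, Prod.map_snd,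
    det_reindex_self, isAlt_reindex, inv_reindex, transpose_reindex, one_sub_reindex,
    reindex_mul_reindex]
  refine and_congr_right fun _ => ?_
  rw [← (reindex e e).apply_eq_iff_eq]
  rfl

theorem leviSum_reindex [Algebra (ZMod 2) F] (e : ι ≃ κ) (D : Matrix ι ι F) (a : F) :
    leviSum (reindex e e D) a = leviSum D a := by
  symm
  unfold leviSum
  refine Fintype.sum_equiv (reindex e e) _ _ fun A => ?_
  simp only [det_reindex_self, inv_reindex, transpose_reindex, one_sub_reindex,
    reindex_mul_reindex, trace_reindex_self, (reindex e e).apply_eq_iff_eq]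

theorem inv_lower_fromBlocks {A : Matrix α α F} {D : Matrix β β F} (hA : A.det ≠ 0)
    (hD : D.det ≠ 0) (C : Matrix β α F) :
    (fromBlocks A 0 C D)⁻¹ = fromBlocks A⁻¹ 0 (-(D⁻¹ * C * A⁻¹)) D⁻¹ := by
  refine inv_fromBlocks_zero₁₂_of_isUnit_iff A C D ?_
  simp [isUnit_iff_isUnit_det, hA, hD]

theorem one_sub_fromBlocks_one :
    (1 - fromBlocks 1 0 0 0 : Matrix (α ⊕ β) (α ⊕ β) F) = fromBlocks 0 0 0 1 := by
  rw [← fromBlocks_one, sub_eq_add_neg, fromBlocks_neg, fromBlocks_add]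
  simp

/-- The condition says that the upper right block of A and the upper left block of B vanish. Its
lower left part is then automatic, since the inverse transpose of A is block upper triangular. -/
theorem stabCard_fromBlocks :
    stabCard (fromBlocks 1 0 0 0 : Matrix (α ⊕ β) (α ⊕ β) F) =
      glCard α F * glCard β F * Fintype.card F ^ (Fintype.card α * Fintype.card β) *
        (Fintype.card F ^ (Fintype.card α * Fintype.card β) * altCard β F) := by
  have h : glCard α F * glCard β F * Fintype.card F ^ (Fintype.card α * Fintype.card β) *
        (Fintype.card F ^ (Fintype.card α * Fintype.card β) * altCard β F) =
      ((((Finset.univ.filter fun A : Matrix α α F => A.det ≠ 0) ×ˢ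
          (Finset.univ.filter fun A : Matrix β β F => A.det ≠ 0)) ×ˢ
          (Finset.univ : Finset (Matrix β α F))) ×ˢ
        ((Finset.univ : Finset (Matrix α β F)) ×ˢ
          (Finset.univ.filter fun B : Matrix β β F => IsAlt B))).card := by
    simp only [Finset.card_product, Finset.card_univ, card_matrix, glCard, altCard]
    rw [mul_comm (Fintype.card β)]
  rw [h]
  symm
  unfold stabCard
  refine Finset.card_bij (fun x _ => (fromBlocks x.1.1.1 0 x.1.2 x.1.1.2,
    fromBlocks 0 x.2.1 (-x.2.1ᵀ) x.2.2)) ?_ ?_ ?_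
  · rintro ⟨⟨⟨A, D⟩, C⟩, B, X⟩ hx
    simp only [Finset.mem_product, Finset.mem_filter, Finset.mem_univ, true_and, and_true] at hx
    obtain ⟨⟨hA, hD⟩, hX⟩ := hx
    refine Finset.mem_filter.2 ⟨mem_parPairs.2 ⟨?_, isAlt_fromBlocks.2 ⟨IsAlt.zero, rfl, hX⟩⟩, ?_⟩
    · simp [det_fromBlocks_zero₁₂, hA, hD]
    · simp [inv_lower_fromBlocks hA hD, one_sub_fromBlocks_one, fromBlocks_multiply,
        fromBlocks_transpose]
  · rintro ⟨⟨⟨A, D⟩, C⟩, B, X⟩ - ⟨⟨⟨A', D'⟩, C'⟩, B', X'⟩ - h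
    simp only [Prod.mk.injEq, fromBlocks_inj] at h
    obtain ⟨⟨rfl, -, rfl, rfl⟩, -, rfl, -, rfl⟩ := h
    rfl
  · rintro ⟨A, B⟩ hx
    obtain ⟨hx, h0⟩ := Finset.mem_filter.1 hx
    obtain ⟨hA, hB⟩ := mem_parPairs.1 hx
    dsimp only at hA hB h0
    rw [← fromBlocks_toBlocks A] at hA h0 ⊢
    rw [← fromBlocks_toBlocks B] at hB h0 ⊢
    generalize A.toBlocks₁₁ = A₁ at *
    generalize A.toBlocks₁₂ = A₂ at *
    generalize A.toBlocks₂₁ = A₃ at *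
    generalize A.toBlocks₂₂ = A₄ at *
    generalize B.toBlocks₁₁ = B₁ at *
    generalize B.toBlocks₁₂ = B₂ at *
    generalize B.toBlocks₂₁ = B₃ at *
    generalize B.toBlocks₂₂ = B₄ at *
    obtain ⟨hB₁, rfl, hB₄⟩ := isAlt_fromBlocks.1 hB
    have hA₂ : A₂ = 0 := by
      have := congrArg toBlocks₁₂ (h0.trans fromBlocks_zero.symm)
      -- The inverse transpose enters only the lower left block, so it can stay unevaluated while
      -- the upper right block gives A₂ = 0.
      rw [← fromBlocks_toBlocks ((fromBlocks A₁ A₂ A₃ A₄)⁻¹)ᵀ] at this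
      simpa [one_sub_fromBlocks_one, fromBlocks_multiply, fromBlocks_add,
        -fromBlocks_zero] using this
    subst hA₂
    rw [det_fromBlocks_zero₁₂] at hA
    have hA₁ := left_ne_zero_of_mul hA
    have hA₄ := right_ne_zero_of_mul hA
    have hB₁0 : B₁ = 0 := by
      have := congrArg toBlocks₁₁ (h0.trans fromBlocks_zero.symm)
      rw [inv_lower_fromBlocks hA₁ hA₄] at this
      have h2 : A₁ * B₁ = 0 := by
        simpa [one_sub_fromBlocks_one, fromBlocks_multiply, fromBlocks_add,
          fromBlocks_transpose, -fromBlocks_zero] using this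
      rw [← nonsing_inv_mul_cancel_left A₁ B₁ (isUnit_iff_ne_zero.2 hA₁), h2, Matrix.mul_zero]
    subst hB₁0
    exact ⟨(((A₁, A₄), A₃), (B₂, B₄)), by simp [hA₁, hA₄, hB₄], rfl⟩

/-- Symmetry of DA makes A block lower triangular with symmetric first block. Both traces see only
the last diagonal block, so the lower left block contributes a pure power of q. -/
theorem leviSum_fromBlocks [Algebra (ZMod 2) F] (a : F) :
    leviSum (fromBlocks 1 0 0 0 : Matrix (α ⊕ β) (α ⊕ β) F) a =
      symCard α F * (Fintype.card F : ℝ) ^ (Fintype.card α * Fintype.card β) * glSum β a := by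
  have h : ∀ (A : Matrix α α F) (B : Matrix α β F),
      ((fromBlocks 1 0 0 0 : Matrix (α ⊕ β) (α ⊕ β) F) * fromBlocks A B 0 0)ᵀ =
        (fromBlocks 1 0 0 0 : Matrix (α ⊕ β) (α ⊕ β) F) * fromBlocks A B 0 0 ↔
      Aᵀ = A ∧ B = 0 := fun A B => by
    rw [fromBlocks_multiply, fromBlocks_transpose, fromBlocks_inj]
    simp
    tauto
  have h' : ∀ (A : Matrix α α F) (B : Matrix α β F) (C : Matrix β α F) (D : Matrix β β F),
      (fromBlocks 1 0 0 0 : Matrix (α ⊕ β) (α ⊕ β) F) * fromBlocks A B C D =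
      (fromBlocks 1 0 0 0 : Matrix (α ⊕ β) (α ⊕ β) F) * fromBlocks A B 0 0 := fun A B C D => by
    simp [fromBlocks_multiply]
  unfold leviSum
  rw [sum_blocks]
  simp only [h', h]
  have hsym : (symCard α F : ℝ) = ∑ A : Matrix α α F, if Aᵀ = A ∧ A.det ≠ 0 then (1 : ℝ) else 0 := by
    simp [symCard]
  rw [hsym, Finset.sum_mul, Finset.sum_mul]
  refine Finset.sum_congr rfl fun A _ => ?_
  rw [Finset.sum_eq_single 0]
  · rw [glSum, mul_assoc, ← Nat.cast_pow, mul_comm (Fintype.card α), ← card_matrix (F := F) β α,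
      ← Finset.card_univ, ← nsmul_eq_mul, ← Finset.sum_const, Finset.mul_sum]
    refine Finset.sum_congr rfl fun C _ => ?_
    rw [Finset.mul_sum]
    refine Finset.sum_congr rfl fun D _ => ?_
    by_cases hA : A.det = 0
    · simp [hA]
    by_cases hD : D.det = 0
    · simp [hD]
    by_cases hs : Aᵀ = A
    · simp [hA, hD, hs, inv_lower_fromBlocks hA hD, one_sub_fromBlocks_one, fromBlocks_multiply,
        trace_fromBlocks_eq]
    · simp [hs]
  · intro B _ hB
    simp [hB]
  · simp

end Parabolic

/-! ### The codes attached to the double cosets -/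

section Codes

variable {F : Type*} [Field F] [Fintype F] [DecidableEq F]

/-- The projection on the first `r` coordinates. -/
def headProj (F : Type*) [Field F] (n r : ℕ) : Matrix (Fin n) (Fin n) F :=
  Matrix.diagonal fun i : Fin n => if (i : ℕ) < r then 1 else 0

theorem headProj_mul_self (n r : ℕ) : headProj F n r * headProj F n r = headProj F n r := by
  rw [headProj, diagonal_mul_diagonal]
  congr 1
  ext i
  simp

theorem headProj_transpose (n r : ℕ) : (headProj F n r)ᵀ = headProj F n r :=
  diagonal_transpose _

theorem swapMat_headProj (n r : ℕ) : swapMat (headProj F n r) = sigmaMat F n r := by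
  have : 1 - headProj F n r = Matrix.diagonal fun i : Fin n => if (i : ℕ) < r then 0 else 1 := by
    rw [headProj, ← diagonal_one, diagonal_sub]
    congr 1
    ext i
    split_ifs <;> simp
  rw [swapMat, sigmaMat, this]
  rfl

theorem headProj_reindex (r t : ℕ) :
    reindex finSumFinEquiv finSumFinEquiv (fromBlocks 1 0 0 0 : Matrix (Fin r ⊕ Fin t) _ F) =
      headProj F (r + t) r := by
  rw [← (reindex (finSumFinEquiv (m := r) (n := t)) finSumFinEquiv).symm.injective.eq_iff,
    Equiv.symm_apply_apply]
  have : (fromBlocks 1 0 0 0 : Matrix (Fin r ⊕ Fin t) (Fin r ⊕ Fin t) F) =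
      Matrix.diagonal (Sum.elim (fun _ => 1) fun _ => 0) := by
    rw [← fromBlocks_diagonal]
    simp
  rw [this, headProj, reindex_symm, reindex_apply, submatrix_diagonal_equiv]
  congr 1
  ext (i | i) <;> simp

theorem coe_parFinset (n : ℕ) : (parFinset (Fin n) F : Set _) = parabolic F n := by
  ext X
  rw [Finset.mem_coe, mem_parFinset, parabolic]
  constructor
  · rintro ⟨A, B, hA, hB, rfl⟩
    refine ⟨GeneralLinearGroup.mkOfDetNeZero A hA, B, hB, ?_⟩
    rw [coe_units_inv, fromBlocks_multiply]
    simp [parMat, GeneralLinearGroup.mkOfDetNeZero]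
  · rintro ⟨A, B, hB, rfl⟩
    refine ⟨A, B, A.det_ne_zero, hB, ?_⟩
    rw [coe_units_inv, fromBlocks_multiply]
    simp [parMat]

theorem mem_cosetFinset_headProj {n i : ℕ} {X : Matrix (Fin n ⊕ Fin n) (Fin n ⊕ Fin n) F} :
    X ∈ cosetFinset (headProj F n (n - i)) ↔ X ∈ DC F n i := by
  rw [DC, DoubleCoset.mem_doubleCoset, ← coe_parFinset, cosetFinset, swapMat_headProj]
  simp only [Finset.mem_image, Finset.mem_product, Prod.exists, Finset.mem_coe]
  constructor
  · rintro ⟨x, y, ⟨hx, hy⟩, rfl⟩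
    exact ⟨x, hx, y, hy, rfl⟩
  · rintro ⟨x, hx, y, hy, rfl⟩
    exact ⟨x, y, ⟨hx, hy⟩, rfl⟩

theorem sum_ordering {n i N : ℕ} (g : Fin N ≃ DC F n i)
    (f : Matrix (Fin n ⊕ Fin n) (Fin n ⊕ Fin n) F → ℝ) :
    ∑ j, f (g j) = ∑ w ∈ cosetFinset (headProj F n (n - i)), f w := by
  have : Fintype (DC F n i) := Fintype.ofEquiv _ g
  rw [g.sum_comp (fun w : DC F n i => f w)]
  exact (Finset.sum_subtype _ (fun w => mem_cosetFinset_headProj) f).symm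

variable [Algebra (ZMod 2) F]

theorem codeword_mem_dualCode {n i N : ℕ} (g : Fin N ≃ DC F n i) (a : F) :
    codeword g a ∈ dualCode (binaryCode (traceVec g)) := by
  intro u hu
  have hu' : ∑ j, algebraMap (ZMod 2) F (u j) * traceVec g j = 0 := hu
  have : ∑ j, codeword g a j * u j =
      Algebra.trace (ZMod 2) F (a * ∑ j, algebraMap (ZMod 2) F (u j) * traceVec g j) := by
    rw [Finset.mul_sum, map_sum]
    refine Finset.sum_congr rfl fun j _ => ?_
    rw [mul_left_comm, ← Algebra.smul_def, map_smul, smul_eq_mul, mul_comm]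
    rfl
  rw [this, hu', mul_zero, map_zero]

theorem lam_eq_one_sub (x : F) :
    lam F x = 1 - 2 * if Algebra.trace (ZMod 2) F x ≠ 0 then 1 else 0 := by
  change (-1 : ℝ) ^ (Algebra.trace (ZMod 2) F x).val = _
  generalize Algebra.trace (ZMod 2) F x = s
  obtain rfl | rfl : s = 0 ∨ s = 1 := by
    revert s
    decide
  · simp
  · norm_num [ZMod.val_one]

theorem two_mul_hammingNorm {n i N : ℕ} (g : Fin N ≃ DC F n i) (a : F) :
    2 * (hammingNorm (codeword g a) : ℝ) =
      ∑ _w ∈ cosetFinset (headProj F n (n - i)), 1 -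
        ∑ w ∈ cosetFinset (headProj F n (n - i)), lam F (a * w.trace) := by
  rw [← sum_ordering g, ← sum_ordering g (fun w => lam F (a * w.trace)), ← Finset.sum_sub_distrib]
  have : (hammingNorm (codeword g a) : ℝ) = ∑ j, if codeword g a j ≠ 0 then (1 : ℝ) else 0 := by
    rw [hammingNorm, Finset.card_filter, Nat.cast_sum]
    simp only [Nat.cast_ite, Nat.cast_one, Nat.cast_zero]
  rw [this, Finset.mul_sum]
  refine Finset.sum_congr rfl fun j _ => ?_
  rw [lam_eq_one_sub]
  rw [sub_sub_cancel]
  rfl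

/-- The trivial character counts the double coset and λ gives the exponential sum; the left factor
is |P ∩ σPσ|. The exponent (r + t)(r + t - 1) is that of the squared number of alternating matrices,
one factor from |P| and one from the sum over B. -/
theorem stabCard_mul_hammingNorm {r t N : ℕ} (g : Fin N ≃ DC F (r + t) t) {a : F} (ha : a ≠ 0) :
    (glCard (Fin r) F * glCard (Fin t) F * (Fintype.card F : ℝ) ^ (r * t) *
      ((Fintype.card F : ℝ) ^ (r * t) * (Fintype.card F : ℝ) ^ t.choose 2)) *
        (2 * (hammingNorm (codeword g a) : ℝ)) =
      glCard (Fin (r + t)) F * (Fintype.card F : ℝ) ^ ((r + t) * (r + t - 1)) *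
        (glCard (Fin (r + t)) F -
          symCard (Fin r) F * (Fintype.card F : ℝ) ^ (r * t) * glSum (Fin t) a) := by
  have hD := headProj_mul_self (F := F) (r + t) r
  have hD' := headProj_transpose (F := F) (r + t) r
  have h1 := stabCard_mul_sum hD hD' (fun _ => 1)
  have h2 := stabCard_mul_sum hD hD' (fun x => lam F (a * x))
  have h3 : (∑ x ∈ parPairs (Fin (r + t)) F, (1 : ℝ)) =
      glCard (Fin (r + t)) F * altCard (Fin (r + t)) F := by
    rw [Finset.sum_const, parPairs, Finset.card_product]
    simp [glCard, altCard]
  have h4 : (r + t) * (r + t - 1) = (r + t).choose 2 + (r + t).choose 2 := by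
    rw [Nat.choose_two_right, ← two_mul, Nat.mul_div_cancel' (Nat.even_mul_pred_self _).two_dvd]
  rw [h3] at h1
  rw [sum_parPairs_lam ha, ← headProj_reindex, leviSum_reindex, leviSum_fromBlocks,
    Fintype.card_fin, Fintype.card_fin] at h2
  rw [headProj_reindex] at h2
  have hst : (stabCard (headProj F (r + t) r) : ℝ) =
      glCard (Fin r) F * glCard (Fin t) F * (Fintype.card F : ℝ) ^ (r * t) *
      ((Fintype.card F : ℝ) ^ (r * t) * (Fintype.card F : ℝ) ^ t.choose 2) := by
    rw [← headProj_reindex, stabCard_reindex, stabCard_fromBlocks, altCard_fin]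
    simp
  rw [two_mul_hammingNorm, Nat.add_sub_cancel, ← hst, mul_sub, h1, h2, altCard_fin, h4, pow_add]
  push_cast
  ring

/-! ### Solving for the weights when t = 1 and t = 2. -/

theorem one_lt_card : (1 : ℝ) < Fintype.card F := by
  exact_mod_cast Fintype.one_lt_card

theorem glCard_succ (n : ℕ) : (glCard (Fin (n + 1)) F : ℝ) =
    (Fintype.card F : ℝ) ^ n * ((Fintype.card F : ℝ) ^ (n + 1) - 1) * glCard (Fin n) F := by
  rw [glCard_fin, glCard_fin, Finset.prod_range_succ, Nat.choose_succ_succ', Nat.choose_one_right,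
    pow_add]
  ring

theorem glCard_zero : glCard (Fin 0) F = 1 := by
  simp [glCard, card_matrix]

theorem glCard_ne_zero (n : ℕ) : (glCard (Fin n) F : ℝ) ≠ 0 := by
  have hq := one_lt_card (F := F)
  rw [glCard_fin]
  exact mul_ne_zero (pow_ne_zero _ (by positivity)) (Finset.prod_ne_zero_iff.2 fun j _ =>
    (sub_pos.2 (one_lt_pow₀ hq (Nat.succ_ne_zero j))).ne')

/-- B is the ratio of |GL(r + 1, q)| to the coefficient of the Kloosterman sum; `hB` is all that the
two parities of n need to supply. -/
theorem hammingNorm_one {r N : ℕ} (g : Fin N ≃ DC F (r + 1) 1) {a : F} (ha : a ≠ 0) {B : ℝ}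
    (hB : B * symCard (Fin r) F * (Fintype.card F : ℝ) ^ r = glCard (Fin (r + 1)) F) :
    (hammingNorm (codeword g a) : ℝ) =
      1 / 2 * ((Fintype.card F : ℝ) ^ ((r + 1) * r) * qBinom (Fintype.card F) (r + 1) 1 *
        symCard (Fin r) F) * (B - kloosterman (lam F) a) := by
  have hq := one_lt_card (F := F)
  have h := stabCard_mul_hammingNorm g ha
  have hg := glCard_succ (F := F) r
  have h1 : (glCard (Fin 1) F : ℝ) = (Fintype.card F : ℝ) - 1 := by
    rw [glCard_succ, glCard_zero]
    simp
  have hr0 := glCard_ne_zero (F := F) r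
  rw [glSum_one ha, mul_one, Nat.add_sub_cancel, h1, show Nat.choose 1 2 = 0 from rfl] at h
  simp only [qBinom, Finset.prod_range_one, tsub_zero, pow_one]
  generalize (Fintype.card F : ℝ) = x at *
  have hx : x ≠ 0 := by positivity
  have hx1 : x - 1 ≠ 0 := (sub_pos.2 hq).ne'
  have hr : x ^ r ≠ 0 := pow_ne_zero _ hx
  -- With the powers of q and the group orders replaced by indeterminates, what remains is
  -- polynomial algebra.
  generalize x ^ ((r + 1) * r) = X at *
  generalize x ^ (r + 1) = y at *
  generalize x ^ r = z at *
  generalize (glCard (Fin (r + 1)) F : ℝ) = G' at *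
  generalize (glCard (Fin r) F : ℝ) = G at *
  generalize (symCard (Fin r) F : ℝ) = S at *
  generalize kloosterman (lam F) a = K at *
  have key : 2 * (x - 1) * (hammingNorm (codeword g a) : ℝ) = X * (y - 1) * S * (B - K) := by
    refine mul_left_cancel₀ (mul_ne_zero hr0 (mul_ne_zero hr hr)) ?_
    linear_combination h + X * (G' - S * z * K) * hg - z * (y - 1) * G * X * hB
  field_simp
  linear_combination key

/-- The sum over GL(2, q) is q(K² + q² - q): its factor q accounts for the exponent 2r + 1 in `hB`,
and the rest for the shift by -q² + q. -/
theorem hammingNorm_two {r N : ℕ} (g : Fin N ≃ DC F (r + 2) 2) {a : F} (ha : a ≠ 0) {B : ℝ}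
    (hB : B * symCard (Fin r) F * (Fintype.card F : ℝ) ^ (2 * r + 1) = glCard (Fin (r + 2)) F) :
    (hammingNorm (codeword g a) : ℝ) =
      1 / 2 * ((Fintype.card F : ℝ) ^ ((r + 2) * (r + 1)) * qBinom (Fintype.card F) (r + 2) 2 *
        symCard (Fin r) F) * (B - (Fintype.card F : ℝ) ^ 2 + Fintype.card F -
          kloosterman (lam F) a ^ 2) := by
  have hq := one_lt_card (F := F)
  have h := stabCard_mul_hammingNorm g ha
  have hg : (glCard (Fin (r + 2)) F : ℝ) = (Fintype.card F : ℝ) ^ (2 * r) * Fintype.card F *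
      ((Fintype.card F : ℝ) ^ (r + 2) - 1) * ((Fintype.card F : ℝ) ^ (r + 1) - 1) *
        glCard (Fin r) F := by
    rw [glCard_succ (r + 1), glCard_succ r]
    ring
  have h2 : (glCard (Fin 2) F : ℝ) =
      Fintype.card F * ((Fintype.card F : ℝ) - 1) * ((Fintype.card F : ℝ) ^ 2 - 1) := by
    rw [glCard_succ, glCard_succ, glCard_zero]
    simp
    ring
  have hr0 := glCard_ne_zero (F := F) r
  rw [glSum_two ha, h2, show Nat.choose 2 2 = 1 from rfl, pow_one, mul_comm r 2,
    show r + 2 - 1 = r + 1 from rfl] at h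
  simp only [qBinom, Finset.prod_range_succ, Finset.prod_range_zero, one_mul, tsub_zero,
    show r + 2 - 1 = r + 1 from rfl, show 2 - 1 = 1 from rfl, pow_one]
  rw [pow_succ _ (2 * r)] at hB
  generalize (Fintype.card F : ℝ) = x at *
  have hx : x ≠ 0 := by positivity
  have hx1 : x - 1 ≠ 0 := (sub_pos.2 hq).ne'
  have hx2 : x ^ 2 - 1 ≠ 0 := (sub_pos.2 (one_lt_pow₀ hq two_ne_zero)).ne'
  have hr : x ^ (2 * r) ≠ 0 := pow_ne_zero _ hx
  generalize x ^ ((r + 2) * (r + 1)) = X at *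
  generalize x ^ (r + 1) = y at *
  generalize x ^ (r + 2) = y' at *
  generalize x ^ (2 * r) = z at *
  generalize (glCard (Fin (r + 2)) F : ℝ) = G' at *
  generalize (glCard (Fin r) F : ℝ) = G at *
  generalize (symCard (Fin r) F : ℝ) = S at *
  generalize kloosterman (lam F) a = K at *
  have key : 2 * (x - 1) * (x ^ 2 - 1) * (hammingNorm (codeword g a) : ℝ) =
      X * (y - 1) * (y' - 1) * S * (B - x ^ 2 + x - K ^ 2) := by
    refine mul_left_cancel₀ (mul_ne_zero hr0 (mul_ne_zero (mul_ne_zero hr hx)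
      (mul_ne_zero hr hx))) ?_
    linear_combination h + X * (G' - S * z * (x * K ^ 2 + x ^ 2 * (x - 1))) * hg -
      z * x * (y' - 1) * (y - 1) * G * X * hB
  field_simp
  linear_combination key

/-! ### Orders of general linear groups by parity, and comparison with the stated constants. -/

theorem evenProd_succ (q m : ℕ) :
    evenProd q (m + 1) = evenProd q m * ((q : ℝ) ^ (2 * m + 2) - 1) := by
  unfold evenProd
  rw [Finset.prod_Icc_succ_top (by omega)]
  rfl

theorem prod_range_two_mul (q m : ℕ) :
    ∏ j ∈ Finset.range (2 * m), ((q : ℝ) ^ (j + 1) - 1) = evenProd q m * oddProd q m := by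
  induction m with
  | zero => simp [evenProd, oddProd]
  | succ m ih =>
    rw [show 2 * (m + 1) = 2 * m + 1 + 1 by ring, Finset.prod_range_succ, Finset.prod_range_succ,
      ih, evenProd_succ, oddProd_succ]
    ring

theorem glCard_even (m : ℕ) : (glCard (Fin (2 * m)) F : ℝ) =
    (Fintype.card F : ℝ) ^ (m * (2 * (m : ℤ) - 1)) *
      (evenProd (Fintype.card F) m * oddProd (Fintype.card F) m) := by
  rw [glCard_fin, prod_range_two_mul, ← zpow_natCast]
  congr 2
  have : (2 * m).choose 2 = m * (2 * m - 1) := by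
    rw [Nat.choose_two_right, mul_assoc, Nat.mul_div_cancel_left _ two_pos]
  rw [this]
  -- The truncated subtraction 2m - 1 differs from the integer one at m = 0, where the factor m
  -- hides the difference.
  rcases m with _ | m
  · simp
  · push_cast [show 2 * (m + 1) - 1 = 2 * m + 1 by omega]
    ring

theorem glCard_odd (m : ℕ) : (glCard (Fin (2 * m + 1)) F : ℝ) =
    (Fintype.card F : ℝ) ^ (m * (2 * (m : ℤ) + 1)) *
      (evenProd (Fintype.card F) m * oddProd (Fintype.card F) (m + 1)) := by
  rw [glCard_fin, Finset.prod_range_succ, prod_range_two_mul, oddProd_succ, mul_assoc,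
    ← zpow_natCast]
  congr 2
  have : (2 * m + 1).choose 2 = m * (2 * m + 1) := by
    rw [Nat.choose_two_right, Nat.add_sub_cancel, mul_left_comm, Nat.mul_div_cancel_left _ two_pos,
      mul_comm]
  rw [this]
  push_cast
  ring

theorem hammingNorm_one_even {n N : ℕ} (hn : 2 ≤ n) (he : Even n) (g : Fin N ≃ DC F n 1) {a : F}
    (ha : a ≠ 0) : (hammingNorm (codeword g a) : ℝ) =
      1 / 2 * A1plus n (Fintype.card F) *
        (B1plus n (Fintype.card F) - kloosterman (lam F) a) := by
  obtain ⟨m, rfl⟩ : ∃ m, n = 2 * m + 1 + 1 := by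
    obtain ⟨m, rfl⟩ := he
    exact ⟨m - 1, by omega⟩
  have hx : (Fintype.card F : ℝ) ≠ 0 := (one_pos.trans one_lt_card).ne'
  have hS := (symCard_even_odd (F := F) m).2
  have hdiv : (2 * m + 1 + 1) / 2 = m + 1 := by omega
  -- The odd product in |GL| is exactly the one counting symmetric matrices, so B retains the even
  -- product; the powers of q agree because m² + m(m + 1) + (2m + 1) = (m + 1)(2m + 1).
  have hB : B1plus (2 * m + 1 + 1) (Fintype.card F) * symCard (Fin (2 * m + 1)) F *
      (Fintype.card F : ℝ) ^ (2 * m + 1) = glCard (Fin (2 * m + 1 + 1)) F := by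
    have he : ((((2 * m + 1 + 1 : ℕ) : ℤ) - 2) ^ 2 / 4) = (m : ℤ) ^ 2 :=
      Int.ediv_eq_of_eq_mul_right (by norm_num) (by push_cast; ring)
    have key : (Fintype.card F : ℝ) ^ ((m : ℤ) ^ 2) * (Fintype.card F : ℝ) ^ (m * (m + 1)) *
        (Fintype.card F : ℝ) ^ (2 * m + 1) =
        (Fintype.card F : ℝ) ^ (((m + 1 : ℕ) : ℤ) * (2 * ((m + 1 : ℕ) : ℤ) - 1)) := by
      rw [← zpow_natCast, ← zpow_natCast, ← zpow_add₀ hx, ← zpow_add₀ hx]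
      congr 1
      push_cast
      ring
    rw [show 2 * m + 1 + 1 = 2 * (m + 1) by ring] at he hdiv ⊢
    rw [B1plus, hS, glCard_even, ← key, he, hdiv]
    ring
  rw [hammingNorm_one g ha hB]
  congr 2
  have he : (5 * ((2 * m + 1 + 1 : ℕ) : ℤ) ^ 2 - 6 * (2 * m + 1 + 1 : ℕ)) / 4 =
      5 * (m : ℤ) ^ 2 + 7 * m + 2 :=
    Int.ediv_eq_of_eq_mul_right (by norm_num) (by push_cast; ring)
  have key : (Fintype.card F : ℝ) ^ ((2 * m + 1 + 1) * (2 * m + 1)) *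
      (Fintype.card F : ℝ) ^ (m * (m + 1)) =
      (Fintype.card F : ℝ) ^ (5 * (m : ℤ) ^ 2 + 7 * m + 2) := by
    rw [← zpow_natCast, ← zpow_natCast, ← zpow_add₀ hx]
    congr 1
    push_cast
    ring
  rw [A1plus, he, hdiv, ← key, hS]
  ring

theorem hammingNorm_one_odd {n N : ℕ} (ho : Odd n) (g : Fin N ≃ DC F n 1) {a : F}
    (ha : a ≠ 0) : (hammingNorm (codeword g a) : ℝ) =
      1 / 2 * A1minus n (Fintype.card F) *
        (B1minus n (Fintype.card F) - kloosterman (lam F) a) := by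
  obtain ⟨m, rfl⟩ := ho
  have hx : (Fintype.card F : ℝ) ≠ 0 := (one_pos.trans one_lt_card).ne'
  have hS := (symCard_even_odd (F := F) m).1
  have hdiv : (2 * m + 1 - 1) / 2 = m := by omega
  have hB : B1minus (2 * m + 1) (Fintype.card F) * symCard (Fin (2 * m)) F *
      (Fintype.card F : ℝ) ^ (2 * m) = glCard (Fin (2 * m + 1)) F := by
    have he : (((2 * m + 1 : ℕ) : ℤ) ^ 2 - 6 * (2 * m + 1 : ℕ) + 5) / 4 = (m : ℤ) ^ 2 - 2 * m :=
      Int.ediv_eq_of_eq_mul_right (by norm_num) (by push_cast; ring)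
    have key : (Fintype.card F : ℝ) ^ ((m : ℤ) ^ 2 - 2 * m) *
        (Fintype.card F : ℝ) ^ (m * (m + 1)) * (Fintype.card F : ℝ) ^ (2 * m) =
        (Fintype.card F : ℝ) ^ ((m : ℤ) * (2 * (m : ℤ) + 1)) := by
      rw [← zpow_natCast, ← zpow_natCast, ← zpow_add₀ hx, ← zpow_add₀ hx]
      congr 1
      push_cast
      ring
    rw [B1minus, hS, glCard_odd, ← key, he, hdiv, oddProd_succ]
    ring
  rw [hammingNorm_one g ha hB]
  congr 2
  have he : (5 * ((2 * m + 1 : ℕ) : ℤ) ^ 2 - 4 * (2 * m + 1 : ℕ) - 1) / 4 =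
      5 * (m : ℤ) ^ 2 + 3 * m :=
    Int.ediv_eq_of_eq_mul_right (by norm_num) (by push_cast; ring)
  have key : (Fintype.card F : ℝ) ^ ((2 * m + 1) * (2 * m)) *
      (Fintype.card F : ℝ) ^ (m * (m + 1)) =
      (Fintype.card F : ℝ) ^ (5 * (m : ℤ) ^ 2 + 3 * m) := by
    rw [← zpow_natCast, ← zpow_natCast, ← zpow_add₀ hx]
    congr 1
    push_cast
    ring
  rw [A1minus, he, hdiv, ← key, hS]
  ring

theorem hammingNorm_two_even {n N : ℕ} (hn : 2 ≤ n) (he : Even n) (g : Fin N ≃ DC F n 2) {a : F}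
    (ha : a ≠ 0) : (hammingNorm (codeword g a) : ℝ) =
      1 / 2 * A2plus n (Fintype.card F) * (B2plus n (Fintype.card F) -
        (Fintype.card F : ℝ) ^ 2 + Fintype.card F - kloosterman (lam F) a ^ 2) := by
  obtain ⟨m, rfl⟩ : ∃ m, n = 2 * m + 2 := by
    obtain ⟨m, rfl⟩ := he
    exact ⟨m - 1, by omega⟩
  have hx : (Fintype.card F : ℝ) ≠ 0 := (one_pos.trans one_lt_card).ne'
  have hS := (symCard_even_odd (F := F) m).1
  have hdiv : (2 * m + 2 - 2) / 2 = m := by omega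
  -- Here |GL| has one odd and one even factor beyond those in the symmetric count and in the even
  -- product up to m; these are the two separate factors of B.
  have hB : B2plus (2 * m + 2) (Fintype.card F) * symCard (Fin (2 * m)) F *
      (Fintype.card F : ℝ) ^ (2 * (2 * m) + 1) = glCard (Fin (2 * m + 2)) F := by
    have he : (((2 * m + 2 : ℕ) : ℤ) ^ 2 - 8 * (2 * m + 2 : ℕ) + 12) / 4 =
        (m : ℤ) ^ 2 - 2 * m :=
      Int.ediv_eq_of_eq_mul_right (by norm_num) (by push_cast; ring)
    have key : (Fintype.card F : ℝ) ^ ((m : ℤ) ^ 2 - 2 * m) *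
        (Fintype.card F : ℝ) ^ (m * (m + 1)) * (Fintype.card F : ℝ) ^ (2 * (2 * m) + 1) =
        (Fintype.card F : ℝ) ^ (((m + 1 : ℕ) : ℤ) * (2 * ((m + 1 : ℕ) : ℤ) - 1)) := by
      rw [← zpow_natCast, ← zpow_natCast, ← zpow_add₀ hx, ← zpow_add₀ hx]
      congr 1
      push_cast
      ring
    rw [B2plus, he, hdiv, hS, show 2 * m + 2 - 1 = 2 * m + 1 from rfl,
      show 2 * m + 2 = 2 * (m + 1) by ring, glCard_even, ← key, evenProd_succ, oddProd_succ]
    ring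
  rw [hammingNorm_two g ha hB]
  congr 2
  have he : (5 * ((2 * m + 2 : ℕ) : ℤ) ^ 2 - 6 * (2 * m + 2 : ℕ)) / 4 =
      5 * (m : ℤ) ^ 2 + 7 * m + 2 :=
    Int.ediv_eq_of_eq_mul_right (by norm_num) (by push_cast; ring)
  have key : (Fintype.card F : ℝ) ^ ((2 * m + 2) * (2 * m + 1)) *
      (Fintype.card F : ℝ) ^ (m * (m + 1)) =
      (Fintype.card F : ℝ) ^ (5 * (m : ℤ) ^ 2 + 7 * m + 2) := by
    rw [← zpow_natCast, ← zpow_natCast, ← zpow_add₀ hx]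
    congr 1
    push_cast
    ring
  rw [A2plus, he, hdiv, ← key, hS]
  ring

theorem hammingNorm_two_odd {n N : ℕ} (hn : 3 ≤ n) (ho : Odd n) (g : Fin N ≃ DC F n 2) {a : F}
    (ha : a ≠ 0) : (hammingNorm (codeword g a) : ℝ) =
      1 / 2 * A2minus n (Fintype.card F) * (B2minus n (Fintype.card F) -
        (Fintype.card F : ℝ) ^ 2 + Fintype.card F - kloosterman (lam F) a ^ 2) := by
  obtain ⟨m, rfl⟩ : ∃ m, n = 2 * m + 1 + 2 := by
    obtain ⟨m, rfl⟩ := ho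
    exact ⟨m - 1, by omega⟩
  have hx : (Fintype.card F : ℝ) ≠ 0 := (one_pos.trans one_lt_card).ne'
  have hS := (symCard_even_odd (F := F) m).2
  have hdiv : (2 * m + 1 + 2 - 1) / 2 = m + 1 := by omega
  have hB : B2minus (2 * m + 1 + 2) (Fintype.card F) * symCard (Fin (2 * m + 1)) F *
      (Fintype.card F : ℝ) ^ (2 * (2 * m + 1) + 1) = glCard (Fin (2 * m + 1 + 2)) F := by
    have he : (((2 * m + 1 + 2 : ℕ) : ℤ) - 3) ^ 2 / 4 = (m : ℤ) ^ 2 :=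
      Int.ediv_eq_of_eq_mul_right (by norm_num) (by push_cast; ring)
    have key : (Fintype.card F : ℝ) ^ ((m : ℤ) ^ 2) *
        (Fintype.card F : ℝ) ^ (m * (m + 1)) * (Fintype.card F : ℝ) ^ (2 * (2 * m + 1) + 1) =
        (Fintype.card F : ℝ) ^ (((m + 1 : ℕ) : ℤ) * (2 * ((m + 1 : ℕ) : ℤ) + 1)) := by
      rw [← zpow_natCast, ← zpow_natCast, ← zpow_add₀ hx, ← zpow_add₀ hx]
      congr 1
      push_cast
      ring
    rw [B2minus, he, hdiv, hS, show 2 * m + 1 + 2 = 2 * (m + 1) + 1 by ring, glCard_odd, ← key,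
      oddProd_succ _ (m + 1)]
    ring
  rw [hammingNorm_two g ha hB]
  congr 2
  have he : (5 * ((2 * m + 1 + 2 : ℕ) : ℤ) ^ 2 - 8 * (2 * m + 1 + 2 : ℕ) + 3) / 4 =
      5 * (m : ℤ) ^ 2 + 11 * m + 6 :=
    Int.ediv_eq_of_eq_mul_right (by norm_num) (by push_cast; ring)
  have key : (Fintype.card F : ℝ) ^ ((2 * m + 1 + 2) * (2 * m + 1 + 1)) *
      (Fintype.card F : ℝ) ^ (m * (m + 1)) =
      (Fintype.card F : ℝ) ^ (5 * (m : ℤ) ^ 2 + 11 * m + 6) := by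
    rw [← zpow_natCast, ← zpow_natCast, ← zpow_add₀ hx]
    congr 1
    push_cast
    ring
  rw [A2minus, he, hdiv, ← key, hS]
  ring

end Codes

end OrthoKloosterman
end

theorem lemma15 {F : Type*} [Field F] [Fintype F] [DecidableEq F] [Algebra (ZMod 2) F]
    (q : ℕ) (hq : Fintype.card F = q) (a : F) (ha : a ≠ 0) :
    -- `c_1^+`
    (∀ n : ℕ, 2 ≤ n → Even n →
      ∀ g : Fin (OrthoKloosterman.len F n 1) ≃ OrthoKloosterman.DC F n 1,
        OrthoKloosterman.codeword g a ∈
          OrthoKloosterman.dualCode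
            (OrthoKloosterman.binaryCode (OrthoKloosterman.traceVec g)) ∧
        (hammingNorm (OrthoKloosterman.codeword g a) : ℝ) =
          1 / 2 * OrthoKloosterman.A1plus n q *
            (OrthoKloosterman.B1plus n q -
              OrthoKloosterman.kloosterman (OrthoKloosterman.lam F) a)) ∧
    -- `c_1^-`
    (∀ n : ℕ, 1 ≤ n → Odd n →
      ∀ g : Fin (OrthoKloosterman.len F n 1) ≃ OrthoKloosterman.DC F n 1,
        OrthoKloosterman.codeword g a ∈
          OrthoKloosterman.dualCode
            (OrthoKloosterman.binaryCode (OrthoKloosterman.traceVec g)) ∧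
        (hammingNorm (OrthoKloosterman.codeword g a) : ℝ) =
          1 / 2 * OrthoKloosterman.A1minus n q *
            (OrthoKloosterman.B1minus n q -
              OrthoKloosterman.kloosterman (OrthoKloosterman.lam F) a)) ∧
    -- `c_2^+`
    (∀ n : ℕ, 2 ≤ n → Even n →
      ∀ g : Fin (OrthoKloosterman.len F n 2) ≃ OrthoKloosterman.DC F n 2,
        OrthoKloosterman.codeword g a ∈
          OrthoKloosterman.dualCode
            (OrthoKloosterman.binaryCode (OrthoKloosterman.traceVec g)) ∧
        (hammingNorm (OrthoKloosterman.codeword g a) : ℝ) =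
          1 / 2 * OrthoKloosterman.A2plus n q *
            (OrthoKloosterman.B2plus n q - (q : ℝ) ^ 2 + q -
              OrthoKloosterman.kloosterman (OrthoKloosterman.lam F) a ^ 2) ∧
        (hammingNorm (OrthoKloosterman.codeword g a) : ℝ) =
          1 / 2 * OrthoKloosterman.A2plus n q *
            (OrthoKloosterman.B2plus n q - (q : ℝ) ^ 2 -
              OrthoKloosterman.kloostermanDim 2 (OrthoKloosterman.lam F) a)) ∧
    -- `c_2^-`
    (∀ n : ℕ, 3 ≤ n → Odd n →
      ∀ g : Fin (OrthoKloosterman.len F n 2) ≃ OrthoKloosterman.DC F n 2,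
        OrthoKloosterman.codeword g a ∈
          OrthoKloosterman.dualCode
            (OrthoKloosterman.binaryCode (OrthoKloosterman.traceVec g)) ∧
        (hammingNorm (OrthoKloosterman.codeword g a) : ℝ) =
          1 / 2 * OrthoKloosterman.A2minus n q *
            (OrthoKloosterman.B2minus n q - (q : ℝ) ^ 2 + q -
              OrthoKloosterman.kloosterman (OrthoKloosterman.lam F) a ^ 2) ∧
        (hammingNorm (OrthoKloosterman.codeword g a) : ℝ) =
          1 / 2 * OrthoKloosterman.A2minus n q *
            (OrthoKloosterman.B2minus n q - (q : ℝ) ^ 2 -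
              OrthoKloosterman.kloostermanDim 2 (OrthoKloosterman.lam F) a)) := by
  subst hq
  have hK := OrthoKloosterman.kloosterman_sq ha
  refine ⟨fun n hn he g => ⟨OrthoKloosterman.codeword_mem_dualCode g a,
      OrthoKloosterman.hammingNorm_one_even hn he g ha⟩,
    fun n _ ho g => ⟨OrthoKloosterman.codeword_mem_dualCode g a,
      OrthoKloosterman.hammingNorm_one_odd ho g ha⟩,
    fun n hn he g => ⟨OrthoKloosterman.codeword_mem_dualCode g a,
      OrthoKloosterman.hammingNorm_two_even hn he g ha, ?_⟩,
    fun n hn ho g => ⟨OrthoKloosterman.codeword_mem_dualCode g a,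
      OrthoKloosterman.hammingNorm_two_odd hn ho g ha, ?_⟩⟩
  · rw [OrthoKloosterman.hammingNorm_two_even hn he g ha, hK]
    ring
  · rw [OrthoKloosterman.hammingNorm_two_odd hn ho g ha, hK]
    ring
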